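/- **Setting.** Let $\mathcal M$ be an episodic Markov decision process with measurable state space $\mathcal S$, measurable action space $\mathcal A$, horizon $H\ge 1$, transition kernels $\mathbb P_h(\cdot\mid s,a)$, deterministic non-negative measurable rewards $r_h(s,a)$ ($h=1,\dots,H$) and a fixed initial state $s_1$. For a (measurable, deterministic) policy $\pi=(\pi_h)_{h}$ let $V^\pi_h,Q^\pi_h$ be its value functions (expected sum of the rewards from step $h$ on), and $V^\star_h=\sup_\pi V_h^\pi$, $Q^\star_h=\sup_\pi Q_h^\pi$. A policy $\pi$ is $\eta$-optimal if $V_1^\pi(s_1)\ge V_1^\star(s_1)-\eta$. Let $(\mathcal T_h g)(s,a)=r_h(s,a)+\mathbb E_{s'\sim\mathbb P_h(\cdot\mid s,a)}\max_{a'}g(s',a')$. Let $\mathcal F=\mathcal F_1\times\dots\times\mathcal F_H$ and $\mathcal G=\mathcal G_1\times\dots\times\mathcal G_H$, where $\mathcal F_h,\mathcal G_h$ are sets of measurable functions $\mathcal S\times\mathcal A\to[0,1]$; put $f_{H+1}=0$ for every tuple $f$, and $\mathcal F_{H+1}=\{0\}$. (No further bound on the rewards, such as $\sum_h r_h\le 1$,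 is needed.) For $f\in\mathcal F$ let $\pi_f$ be a greedy policy, $\pi_{f,h}(s)\in\arg\max_a f_h(s,a)$, with a fixed rule for breaking ties; the maxima are assumed to be attained. Assume * (realizability) $Q_h^\star\in\mathcal F_h$ for all $h\in[H]$; * (completeness) $\mathcal T_h\mathcal F_{h+1}\subseteq\mathcal G_h$ for all $h\in[H]$ (for $\mathcal G=\mathcal F$ this is $\mathcal T_h\mathcal F_{h+1}\subseteq\mathcal F_h$). $\mathcal N_{\mathcal F\cup\mathcal G}(\rho)$ is the least number of elements of $\mathcal F\cup\mathcal G$ such that every element of $\mathcal F\cup\mathcal G$ is within $\rho$ of one of them in the metric $\max_h\|f_h-g_h\|_\infty$. For a class $\Phi$ of functions on $\mathcal X$, a probability measure $\nu$ on $\mathcal X$ is $\epsilon$-independent of $\mu_1,\dots,\mu_n$ if some $\phi\in\Phi$ has $\sqrt{\sum_{i}(\mathbb E_{\mu_i}\phi)^2}\le\epsilon<|\mathbb E_\nu\phi|$; $\dim_{\rm DE}(\Phi,\Pi,\epsilon)$ is the supremum of the lengths of sequences in $\Pi$ in which, for some $\epsilon'\ge\epsilon$, each member is $\epsilon'$-independent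 of its predecessors; and $\dim_{\rm BE}(\mathcal F,\Pi,\epsilon)=\max_{h}\dim_{\rm DE}(\{f_h-\mathcal T_hf_{h+1}:f\in\mathcal F\},\Pi_h,\epsilon)$. Let $\mathcal D_{\Delta,h}$ be the set of Dirac measures on $\mathcal S\times\mathcal A$, and $\mathcal D_{\mathcal F,h}$ the set of laws of $(s_h,a_h)$ under the policies $\pi_f$, $f\in\mathcal F$. **Algorithm.** GOLF with parameters $K,\beta$ starts from $\mathcal B^0=\mathcal F$ and, in episodes $k=1,\dots,K$, picks $f^k\in\arg\max_{f\in\mathcal B^{k-1}}f_1(s_1,\pi_f(s_1))$ (assumed to be attained whenever $\mathcal B^{k-1}\neq\emptyset$; an arbitrary element of $\mathcal F$ if $\mathcal B^{k-1}=\emptyset$), follows $\pi^k=\pi_{f^k}$ to collect a trajectory $(s^k_1,a^k_1,\dots,s^k_H,a^k_H,s^k_{H+1})$, and sets $$\mathcal B^k=\Big\{f\in\mathcal F:\ L^k_h(f_h,f_{h+1})\le\inf_{g\in\mathcal G_h}L^k_h(g,f_{h+1})+\beta\ \ \forall h\in[H]\Big\},\qquad L^k_h(\xi,\zeta)=\sum_{i=1}^k\big[\xi(s^i_h,a^i_h)-r_h(s_h^i,a_h^i)-\max_{a'}\zeta(s^i_{h+1},a')\big]^2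 .$$ The dependence of $f^k$ and $\pi_{f^k}$ on the past is measurable. The output $\pi^{\rm out}$ is drawn uniformly from $\pi^1,\dots,\pi^K$, independently of the run. **Statement.** For $\epsilon\in(0,1]$ let $$d=\max\Big\{1,\min_{\Pi\in\{\mathcal D_\Delta,\mathcal D_{\mathcal F}\}}\dim_{\rm BE}(\mathcal F,\Pi,\epsilon/H)\Big\},\quad \rho=\frac{\epsilon^2}{H^2d},\quad L=\frac{H^2d}{\epsilon^2}\log\Big[\mathcal N_{\mathcal F\cup\mathcal G}(\rho)\cdot\frac{Hd}{\epsilon}\Big],$$ and suppose that $d$ and $\mathcal N_{\mathcal F\cup\mathcal G}(\rho)$ are finite. For every $m\ge1$ there are constants $c,C>0$ depending only on $m$ (so absolute constants, for $m=1$ say) such that, for all $\mathcal M,\mathcal F,\mathcal G$ as above, all $\epsilon\in(0,1]$ and all integers $K\ge1$ with $K\ge L$, the output $\pi^{\rm out}$ of GOLF is $C\epsilon$-optimal with probability at least $1/2$ in each of the following two cases: 1. $\beta=c\,\big(\log[\mathcal N_{\mathcal F\cup\mathcal G}(\rho)\cdot HK]+K\rho\big)$; 2. $K\le mL$ and $\beta=c\,\log[\mathcal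 N_{\mathcal F\cup\mathcal G}(\rho)\cdot HK]$. -/

import Mathlib

open MeasureTheory ProbabilityTheory

noncomputable section

namespace Golf

/-- An episodic Markov decision process with measurable state and action spaces, horizon `H`,
transition kernels, deterministic non-negative rewards and a fixed initial state.
Steps are numbered `0, …, H - 1`; the data at indices `h ≥ H` are never used. -/
structure MDP (S A : Type*) [MeasurableSpace S] [MeasurableSpace A] where
  H : ℕ
  P : ℕ → Kernel (S × A) S
  markov : ∀ h, IsMarkovKernel (P h)
  r : ℕ → S × A → ℝ
  measurable_r : ∀ h, Measurable (r h)
  r_nonneg : ∀ h x, 0 ≤ r h x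
  s₁ : S

/-- A tuple `f = (f_h)_h` of functions on state-action pairs. -/
abbrev QTuple (S A : Type*) := ℕ → S × A → ℝ

/-- Measurable deterministic policies. -/
def Policy (S A : Type*) [MeasurableSpace S] [MeasurableSpace A] :=
  {π : ℕ → S → A // ∀ h, Measurable (π h)}

section Values

variable {S A : Type*} [MeasurableSpace S] [MeasurableSpace A]

/-- The law of `s_{h+n}` when the policy `π` is followed from `s_h = s`. -/
def stateLaw (M : MDP S A) (π : ℕ → S → A) (h : ℕ) (s : S) : ℕ → Measure S
  | 0 => Measure.dirac s
  | n + 1 => (stateLaw M π h s n).bind (fun x => M.P (h + n) (x, π (h + n) x))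

/-- `V^π_h(s)`: the expected sum of the rewards at the steps `h, …, H - 1`
when `π` is followed from `s_h = s`. -/
def value (M : MDP S A) (π : ℕ → S → A) (h : ℕ) (s : S) : ℝ :=
  ∑ n ∈ Finset.range (M.H - h),
    ∫ x, M.r (h + n) (x, π (h + n) x) ∂(stateLaw M π h s n)

/-- `Q^π_h(s, a)`: the same, when the action at step `h` is `a` and `π` is followed afterwards. -/
def qValue (M : MDP S A) (π : ℕ → S → A) (h : ℕ) (x : S × A) : ℝ :=
  M.r h x + ∫ s', value M π (h + 1) s' ∂(M.P h x)

/-- The optimal value function. -/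
def vStar (M : MDP S A) (h : ℕ) (s : S) : ℝ :=
  ⨆ π : Policy S A, value M π.1 h s

/-- The optimal action-value function. -/
def qStar (M : MDP S A) (h : ℕ) (x : S × A) : ℝ :=
  ⨆ π : Policy S A, qValue M π.1 h x

/-- The Bellman operator `(T_h g)(s, a) = r_h(s, a) + E_{s' ∼ P_h(s, a)} max_{a'} g(s', a')`. -/
def bellman (M : MDP S A) (h : ℕ) (g : S × A → ℝ) (x : S × A) : ℝ :=
  M.r h x + ∫ s', (⨆ a', g (s', a')) ∂(M.P h x)

/-- The law of `(s_h, a_h)` when `π` is followed from the initial state. -/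
def occupancy (M : MDP S A) (π : ℕ → S → A) (h : ℕ) : Measure (S × A) :=
  (stateLaw M π 0 M.s₁ h).map (fun s => (s, π h s))

end Values

section Classes

variable {S A : Type*}

/-- The component classes `F_h`, followed by `{0}` after the last step. -/
def withTerminal (H : ℕ) (F : ℕ → Set (S × A → ℝ)) (h : ℕ) : Set (S × A → ℝ) :=
  if h < H then F h else {0}

/-- The product class `F_1 × ⋯ × F_H`, each tuple being continued by `0` after the last step. -/
def tuples (H : ℕ) (F : ℕ → Set (S × A → ℝ)) : Set (QTuple S A) :=
  {f | ∀ h, f h ∈ withTerminal H F h}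

/-- The `ρ`-covering number, with centres in the set, for the metric `max_h ‖f_h - g_h‖_∞`. -/
def coverNum (V : Set (QTuple S A)) (ρ : ℝ) : ℕ∞ :=
  ⨅ (C : Set (QTuple S A))
    (_ : C ⊆ V ∧ ∀ f ∈ V, ∃ g ∈ C, ∀ h x, |f h x - g h x| ≤ ρ), C.encard

end Classes

section Eluder

/-- `ν` is `ε`-independent of `μ_0, …, μ_{n-1}` with respect to `Φ`. -/
def EpsIndep {X : Type*} [MeasurableSpace X] (Φ : Set (X → ℝ)) (ε : ℝ)
    (n : ℕ) (μ : ℕ → Measure X) (ν : Measure X) : Prop :=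
  ∃ g ∈ Φ, Real.sqrt (∑ i ∈ Finset.range n, (∫ x, g x ∂(μ i)) ^ 2) ≤ ε ∧ ε < |∫ x, g x ∂ν|

/-- The distributional Eluder dimension: the supremum of the lengths of the sequences in `D` each
of whose members is `ε'`-independent of its predecessors, for one common `ε' ≥ ε`. -/
def dimDE {X : Type*} [MeasurableSpace X] (Φ : Set (X → ℝ)) (D : Set (Measure X)) (ε : ℝ) : ℕ∞ :=
  ⨆ (n : ℕ) (_ : ∃ μ : ℕ → Measure X, (∀ i < n, μ i ∈ D) ∧
    ∃ ε' ≥ ε, ∀ i < n, EpsIndep Φ ε' i μ (μ i)), (n : ℕ∞)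

variable {S A : Type*} [MeasurableSpace S] [MeasurableSpace A]

/-- The Bellman residuals `f_h - T_h f_{h+1}`, `f ∈ F`. -/
def residuals (M : MDP S A) (F : ℕ → Set (S × A → ℝ)) (h : ℕ) : Set (S × A → ℝ) :=
  {φ | ∃ f ∈ tuples M.H F, φ = fun x => f h x - bellman M h (f (h + 1)) x}

/-- The Bellman Eluder dimension with respect to the families `D_h` of measures. -/
def dimBE (M : MDP S A) (F : ℕ → Set (S × A → ℝ)) (D : ℕ → Set (Measure (S × A))) (ε : ℝ) : ℕ∞ :=
  ⨆ (h : ℕ) (_ : h < M.H), dimDE (residuals M F h) (D h) ε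

/-- The laws of `(s_h, a_h)` under the greedy policies `π_f`, `f ∈ F`. -/
def greedyFamily (M : MDP S A) (F : ℕ → Set (S × A → ℝ)) (greedy : QTuple S A → ℕ → S → A)
    (h : ℕ) : Set (Measure (S × A)) :=
  {μ | ∃ f ∈ tuples M.H F, μ = occupancy M (greedy f) h}

/-- The Dirac measures at state-action pairs. -/
def diracFamily (S A : Type*) [MeasurableSpace S] [MeasurableSpace A] (_h : ℕ) :
    Set (Measure (S × A)) :=
  {μ | ∃ x : S × A, μ = Measure.dirac x}

end Eluder

section Assumptions

variable {S A : Type*} [MeasurableSpace S] [MeasurableSpace A]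

/-- The component classes consist of measurable functions with values in `[0, 1]`. -/
def IsFunctionClass (H : ℕ) (F : ℕ → Set (S × A → ℝ)) : Prop :=
  ∀ h < H, ∀ f ∈ F h, Measurable f ∧ ∀ x, f x ∈ Set.Icc (0 : ℝ) 1

/-- `f ↦ π_f` is a rule that assigns a greedy policy to each `f ∈ F`:
`π_{f,h}(s)` maximizes `f_h(s, ·)`, ties being broken in an arbitrary fixed way. -/
def IsGreedyRule (H : ℕ) (F : ℕ → Set (S × A → ℝ)) (greedy : QTuple S A → ℕ → S → A) : Prop :=
  ∀ f ∈ tuples H F, (∀ h, Measurable (greedy f h)) ∧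
    ∀ h < H, ∀ s a, f h (s, a) ≤ f h (s, greedy f h s)

/-- Realizability: `Q*_h ∈ F_h`. -/
def Realizable (M : MDP S A) (F : ℕ → Set (S × A → ℝ)) : Prop :=
  ∀ h < M.H, qStar M h ∈ F h

/-- Generalized completeness: `T_h F_{h+1} ⊆ G_h`. For `G = F` this is completeness. -/
def Complete (M : MDP S A) (F G : ℕ → Set (S × A → ℝ)) : Prop :=
  ∀ h < M.H, ∀ g ∈ withTerminal M.H F (h + 1), bellman M h g ∈ G h

end Assumptions

section Algorithm

variable {S A Ω : Type*} [MeasurableSpace S] [MeasurableSpace A]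

/-- The squared loss `L_{D_h}(ξ, ζ)` on the data of step `h` in the first `k` episodes, where `s i h`
and `a i h` are the state and the action at step `h` of episode `i`. -/
def loss (M : MDP S A) (s : ℕ → ℕ → S) (a : ℕ → ℕ → A) (k h : ℕ) (ξ ζ : S × A → ℝ) : ℝ :=
  ∑ i ∈ Finset.range k,
    (ξ (s i h, a i h) - M.r h (s i h, a i h) - ⨆ a', ζ (s i (h + 1), a')) ^ 2

/-- The confidence set after `k` episodes. For `k = 0` and `β ≥ 0` it is the whole class. -/
def confSet (M : MDP S A) (F G : ℕ → Set (S × A → ℝ)) (β : ℝ)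
    (s : ℕ → ℕ → S) (a : ℕ → ℕ → A) (k : ℕ) : Set (QTuple S A) :=
  {f | f ∈ tuples M.H F ∧ ∀ h < M.H,
    loss M s a k h (f h) (f (h + 1)) ≤ (⨅ g : G h, loss M s a k h g (f (h + 1))) + β}

/-- The action `a_h^k = π_{f^k,h}(s_h^k)`. -/
def action (greedy : QTuple S A → ℕ → S → A) (s : ℕ → ℕ → Ω → S) (f : ℕ → Ω → QTuple S A)
    (ω : Ω) (k h : ℕ) : A :=
  greedy (f k ω) h (s k h ω)

/-- A run of GOLF for `K` episodes with parameter `β` on the probability space `(Ω, Pr)`. Episodes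
are numbered from `0`, `s k h` is the state at step `h` of episode `k` (`s k H` being the last one),
and `f k` is the function chosen for episode `k`. The `σ`-algebra `𝓖 k h` is the information
available when the action of step `h` of episode `k` is taken (at least the data collected up to
then). -/
structure IsRun [MeasurableSpace Ω] (Pr : Measure Ω) (M : MDP S A) (F G : ℕ → Set (S × A → ℝ))
    (greedy : QTuple S A → ℕ → S → A) (K : ℕ) (β : ℝ) (𝓖 : ℕ → ℕ → MeasurableSpace Ω)
    (s : ℕ → ℕ → Ω → S) (f : ℕ → Ω → QTuple S A) : Prop where
  le : ∀ k h, 𝓖 k h ≤ ‹MeasurableSpace Ω›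
  mono_step : ∀ k < K, ∀ h < M.H, 𝓖 k h ≤ 𝓖 k (h + 1)
  mono_episode : ∀ k < K, 𝓖 k M.H ≤ 𝓖 (k + 1) 0
  /-- The states are observed. -/
  measurable_state : ∀ k < K, ∀ h ≤ M.H, Measurable[𝓖 k h] (s k h)
  /-- The function of episode `k` and its greedy policy are chosen before the episode. -/
  measurable_fun : ∀ k < K, ∀ h < M.H,
    @Measurable _ _ (@Prod.instMeasurableSpace _ _ (𝓖 k 0) inferInstance) _
      (fun p : Ω × (S × A) => f k p.1 h p.2)
  measurable_policy : ∀ k < K, ∀ h < M.H,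
    @Measurable _ _ (@Prod.instMeasurableSpace _ _ (𝓖 k 0) inferInstance) _
      (fun p : Ω × S => greedy (f k p.1) h p.2)
  /-- Each episode starts at the initial state. -/
  init : ∀ k < K, ∀ ω, s k 0 ω = M.s₁
  /-- Given the past, the next state has the law `P_h(· | s_h, a_h)`. -/
  transition : ∀ k < K, ∀ h < M.H, ∀ E : Set Ω, MeasurableSet[𝓖 k h] E →
    ∀ B : Set S, MeasurableSet B →
      Pr (E ∩ s k (h + 1) ⁻¹' B) = ∫⁻ ω in E, M.P h (s k h ω, action greedy s f ω k h) B ∂Pr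
  /-- The chosen function belongs to the class. -/
  mem : ∀ k < K, ∀ ω, f k ω ∈ tuples M.H F
  /-- Optimistic planning: `f^k` maximizes `f_1(s_1, π_f(s_1))` over the current confidence set.
  (Should that set be empty, any element of the class may be chosen.) -/
  optimistic : ∀ k < K, ∀ ω,
    (confSet M F G β (fun i h => s i h ω) (action greedy s f ω) k).Nonempty →
      f k ω ∈ confSet M F G β (fun i h => s i h ω) (action greedy s f ω) k ∧
      ∀ f' ∈ confSet M F G β (fun i h => s i h ω) (action greedy s f ω) k,
        f' 0 (M.s₁, greedy f' 0 M.s₁) ≤ f k ω 0 (M.s₁, greedy (f k ω) 0 M.s₁)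

/-- The probability that the output policy, drawn uniformly from `π^1, …, π^K` independently of
the run, is `η`-optimal. -/
def probOptimal [MeasurableSpace Ω] (Pr : Measure Ω) (M : MDP S A)
    (greedy : QTuple S A → ℕ → S → A) (K : ℕ) (f : ℕ → Ω → QTuple S A) (η : ℝ) : ENNReal :=
  (Pr.prod (uniformOn (Set.univ : Set (Fin K))))
    {p | vStar M 0 M.s₁ - η ≤ value M (greedy (f p.2 p.1)) 0 M.s₁}

end Algorithm

end Golf

end

/-! The proof combines optimism with a pigeonhole bound through the Eluder dimension.

Optimism. If `Q*` lies in the current confidence set, the value claimed by `f^k` at the initial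
state is at least `V*`. By telescoping along `π^k`, that claim exceeds the true value of `π^k` by
the sum over `h` of the expected Bellman residuals of `f^k` under `π^k`
(`Setting.sub_value_eq_sum_residual`). So the regret of an episode is at most this sum.

Concentration. For fixed `g` and `ζ`, the excess squared loss of `g` over `T_h ζ_{h+1}` at a
transition equals `gap² - 2 * gap * noise`, with noise of conditional mean zero. Hoeffding's lemma
makes the exponential of the partial sums of `logWeight` integrate to at most one
(`IsRun.lintegral_exp_sum_logWeight_le`). The increment also carries multiples of the observed and
the expected squared gap, so one tail bound, extended to the whole class by a cover, does two
things. With `ζ = Q*` it keeps `Q*` in every confidence set. With `g = f_h`, `ζ = f`, and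
completeness making `T_h f_{h+1}` a competitor in the infimum, it shows that the residuals of `f^k`
have square sum `O(β)` over the earlier episodes, both at the visited pairs and in expectation under
the earlier policies (`IsRun.sum_gap_le`).

Eluder bound. Functions with square sum at most `b` on the earlier measures have total error at most
`Kω + d + 2√(dbK)` on the current ones (`sum_abs_integral_le_of_dimDE`). For the greedy family it
applies to the occupancy measures directly. For Dirac measures it applies to the visited pairs, and
the two kinds of residual have the same expectation (`IsRun.integral_meanResidual`); regret is
therefore bounded in expectation, and no second martingale bound is needed.

Parameters. `K ≥ L` gives `log (N H K) ≤ 4 K ρ`, so `β` and the concentration level are `O(Kρ)`.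
With `ω = ε / H` and `ρ = ε² / (H² d)` the square root is `O(K ε / H)`, and summing over `H` steps
gives expected regret `O(K ε)`. Markov's inequality for the uniformly drawn index concludes. -/

noncomputable section

namespace Golf

/-! ### Counting by repeated extraction of independent subsets. -/

section EluderCounting

/-- From a finite set `T` one can select a subset `I` each of whose members is `η`-independent of
its predecessors in `I`, while each member of `T \ I` is `η`-dependent on its predecessors in `I`;
the dependence of `k` on `t` is measured by the weight `w t k`. -/
theorem exists_greedy_independent (w : ℕ → ℕ → ℝ) (η : ℝ) (T : Finset ℕ) :
    ∃ I ⊆ T, (∀ k ∈ I, ∑ t ∈ I with t < k, w t k ≤ η) ∧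
      ∀ k ∈ T \ I, η < ∑ t ∈ I with t < k, w t k := by
  induction T using Finset.induction_on_max with
  | empty => exact ⟨∅, by simp⟩
  | insert a T ha ih =>
    obtain ⟨I, hIT, hI, hT⟩ := ih
    have haI : a ∉ I := fun h => lt_irrefl _ (ha a (hIT h))
    -- The set is scanned in increasing order: the new maximum `a` joins `I` exactly when its
    -- dependence on `I` is small, and it precedes no earlier member.
    by_cases hc : ∑ t ∈ I with t < a, w t a ≤ η
    · have key : ∀ k ∈ T, ∑ t ∈ insert a I with t < k, w t k = ∑ t ∈ I with t < k, w t k := by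
        intro k hk
        rw [Finset.filter_insert, if_neg (not_lt.mpr (ha k hk).le)]
      refine ⟨insert a I, Finset.insert_subset_insert _ hIT, ?_, ?_⟩
      · intro k hk
        rcases Finset.mem_insert.mp hk with rfl | hk
        · rw [Finset.filter_insert, if_neg (lt_irrefl _)]
          exact hc
        · rw [key k (hIT hk)]
          exact hI k hk
      · intro k hk
        simp only [Finset.mem_sdiff, Finset.mem_insert, not_or] at hk
        have hkT : k ∈ T := hk.1.resolve_left hk.2.1
        rw [key k hkT]
        exact hT k (Finset.mem_sdiff.mpr ⟨hkT, hk.2.2⟩)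
    · refine ⟨I, hIT.trans (Finset.subset_insert _ _), hI, ?_⟩
      intro k hk
      simp only [Finset.mem_sdiff, Finset.mem_insert] at hk
      rcases hk.1 with rfl | hkT
      · exact not_le.mp hc
      · exact hT k (Finset.mem_sdiff.mpr ⟨hkT, hk.2⟩)

/-- If independent subsets have at most `d` members and the total dependence of every member of
`T` is below `n η`, then `T` has at most `n d` members. -/
theorem card_le_mul_of_sum_lt (w : ℕ → ℕ → ℝ) (η : ℝ) (d : ℕ) (hw : ∀ t k, 0 ≤ w t k)
    (n : ℕ) : ∀ T : Finset ℕ,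
    (∀ I ⊆ T, (∀ k ∈ I, ∑ t ∈ I with t < k, w t k ≤ η) → I.card ≤ d) →
    (∀ k ∈ T, ∑ t ∈ T with t < k, w t k < n * η) → T.card ≤ n * d := by
  induction n with
  | zero =>
    intro T _ hT
    have : T = ∅ := by
      refine Finset.eq_empty_of_forall_notMem fun k hk => ?_
      have h1 := hT k hk
      have h2 : 0 ≤ ∑ t ∈ T with t < k, w t k := Finset.sum_nonneg fun _ _ => hw _ _
      simp only [Nat.cast_zero, zero_mul] at h1
      linarith
    simp [this]
  | succ n ih =>
    intro T hd hT
    -- One round removes an independent set of at most `d` members and takes more than `η` from the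
    -- total dependence of each survivor, so `n` rounds exhaust `T`.
    obtain ⟨I, hIT, hI, hrest⟩ := exists_greedy_independent w η T
    have h1 := hd I hIT hI
    have h2 : (T \ I).card ≤ n * d := by
      refine ih _ (fun J hJ => hd J (hJ.trans Finset.sdiff_subset)) fun k hk => ?_
      have h3 := hT k (Finset.mem_sdiff.mp hk).1
      have h4 := hrest k hk
      have h5 : ∑ t ∈ T with t < k, w t k
          = ∑ t ∈ T \ I with t < k, w t k + ∑ t ∈ I with t < k, w t k := by
        simp only [Finset.sum_filter]
        exact (Finset.sum_sdiff hIT).symm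
      push_cast at h3
      linarith
    have h6 : (T \ I).card + I.card = T.card := Finset.card_sdiff_add_card_eq_card hIT
    rw [add_mul, one_mul]
    omega

theorem sum_inv_sqrt_le (n : ℕ) :
    ∑ i ∈ Finset.range n, 1 / √((i : ℝ) + 1) ≤ 2 * √n := by
  induction n with
  | zero => simp
  | succ n ih =>
    rw [Finset.sum_range_succ]
    have hn : (0 : ℝ) ≤ n := Nat.cast_nonneg n
    have h1 : 0 < √((n : ℝ) + 1) := Real.sqrt_pos.mpr (by positivity)
    have h2 : √((n : ℝ) + 1) ^ 2 = n + 1 := Real.sq_sqrt (by positivity)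
    have h3 : √(n : ℝ) ^ 2 = n := Real.sq_sqrt hn
    have h4 : 1 / √((n : ℝ) + 1) ≤ 2 * √((n : ℝ) + 1) - 2 * √n := by
      rw [div_le_iff₀ h1]
      nlinarith [sq_nonneg (√((n : ℝ) + 1) - √n)]
    push_cast
    linarith

/-- If for every `u ≥ ω` at most `d (b / u² + 1)` of the numbers `e k ∈ [0, 1]`, `k ∈ T`, exceed
`u`, and all of them exceed `ω`, then their sum is at most `d + 2 √(d b |T|)`. -/
theorem sum_le_of_count_le (e : ℕ → ℝ) (ω b : ℝ) (d : ℕ) (hω : 0 < ω) (hb : 0 ≤ b)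
    (T : Finset ℕ) (h1 : ∀ k ∈ T, e k ≤ 1) (hlt : ∀ k ∈ T, ω < e k)
    (hcount : ∀ u, ω ≤ u → ∀ T' ⊆ T, (∀ k ∈ T', u < e k) → (T'.card : ℝ) ≤ d * (b / u ^ 2 + 1)) :
    ∑ k ∈ T, e k ≤ d + 2 * √(d * b * T.card) := by
  have hcount' : ∀ k ∈ T, ∀ T' ⊆ T, (∀ j ∈ T', e k ≤ e j) →
      (T'.card : ℝ) ≤ d * (b / e k ^ 2 + 1) := by
    intro k hk T' hT' hj
    have hek : 0 < e k := hω.trans (hlt k hk)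
    -- The hypothesis counts values strictly above `u`; letting `u` increase to `e k` counts those
    -- that are at least `e k`.
    have ht : Filter.Tendsto (fun u : ℝ => d * (b / u ^ 2 + 1)) (nhdsWithin (e k) (Set.Iio (e k)))
        (nhds (d * (b / e k ^ 2 + 1))) := by
      refine Filter.Tendsto.mono_left ?_ nhdsWithin_le_nhds
      have : ContinuousAt (fun u : ℝ => d * (b / u ^ 2 + 1)) (e k) := by
        fun_prop (disch := positivity)
      exact this
    refine ge_of_tendsto ht ?_
    filter_upwards [Ioo_mem_nhdsLT (hlt k hk)] with u hu
    exact hcount u hu.1.le T' hT' fun j hjT => hu.2.trans_le (hj j hjT)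
  -- In decreasing order, the `j`-th largest value `v` satisfies `j ≤ d (b / v² + 1)`, so `v ≤ √(d b
  -- / (j - d))` once `j > d`. Inserting minima last realizes this order.
  have main : ∀ T' ⊆ T, ∑ k ∈ T', e k ≤
      d + ∑ i ∈ Finset.range (T'.card - d), √(d * b) * (1 / √((i : ℝ) + 1)) := by
    intro T'
    induction T' using Finset.induction_on_min_value e with
    | empty => intro _; simp
    | insert a T' ha hmin ih =>
      intro hsub
      have haT : a ∈ T := hsub (Finset.mem_insert_self _ _)
      have hT'T : T' ⊆ T := (Finset.subset_insert _ _).trans hsub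
      have ih := ih hT'T
      rw [Finset.sum_insert ha, Finset.card_insert_of_notMem ha]
      -- The first `d` values are bounded by one each; truncated subtraction leaves the other sum
      -- empty meanwhile.
      by_cases hcd : T'.card < d
      · have h0 : T'.card + 1 - d = 0 := by omega
        rw [h0, Finset.sum_range_zero, add_zero]
        have : ∑ k ∈ T', e k ≤ T'.card := by
          simpa using Finset.sum_le_card_nsmul T' e 1 fun k hk => h1 k (hT'T hk)
        have h2 : (T'.card : ℝ) + 1 ≤ d := by exact_mod_cast hcd
        linarith [h1 a haT]
      · have h0 : T'.card + 1 - d = (T'.card - d) + 1 := by omega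
        rw [h0, Finset.sum_range_succ]
        have hea : 0 < e a := hω.trans (hlt a haT)
        have hc := hcount' a haT (insert a T') hsub fun j hj => by
          rcases Finset.mem_insert.mp hj with rfl | hj
          · exact le_rfl
          · exact hmin j hj
        rw [Finset.card_insert_of_notMem ha] at hc
        have hcast : ((T'.card - d : ℕ) : ℝ) = T'.card - d := by
          rw [Nat.cast_sub (not_lt.mp hcd)]
        have hx : (0 : ℝ) < ((T'.card - d : ℕ) : ℝ) + 1 := by positivity
        have : e a ≤ √(d * b) * (1 / √(((T'.card - d : ℕ) : ℝ) + 1)) := by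
          rw [mul_one_div, ← Real.sqrt_div (by positivity)]
          refine Real.le_sqrt_of_sq_le ?_
          rw [le_div_iff₀ hx, hcast]
          push_cast at hc
          have h3 : (d : ℝ) * (b / e a ^ 2 + 1) = d * b / e a ^ 2 + d := by ring
          have h4 : (T'.card : ℝ) - d + 1 ≤ d * b / e a ^ 2 := by linarith
          rw [le_div_iff₀ (by positivity)] at h4
          linarith
        linarith
  refine (main T subset_rfl).trans ?_
  rw [← Finset.mul_sum]
  have h2 := sum_inv_sqrt_le (T.card - d)
  have h3 : √((T.card - d : ℕ) : ℝ) ≤ √(T.card : ℝ) :=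
    Real.sqrt_le_sqrt (by exact_mod_cast Nat.sub_le _ _)
  have h4 : √(d * b * T.card) = √(d * b) * √(T.card : ℝ) := Real.sqrt_mul (by positivity) _
  have h5 : 0 ≤ √(d * b) := Real.sqrt_nonneg _
  have h6 := mul_le_mul_of_nonneg_left (h2.trans (mul_le_mul_of_nonneg_left h3 zero_le_two)) h5
  rw [h4]
  linarith

end EluderCounting

/-! ### Cumulative error under a bounded distributional Eluder dimension. -/

section EluderSum

variable {X : Type*} [MeasurableSpace X]

/-- Enumerating `I` increasingly turns it into a sequence as in `dimDE`. The definition admits any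
common scale above `ω`, here `u`, so the dimension at `ω` controls all larger scales. -/
theorem card_le_of_independent {Φ : Set (X → ℝ)} {D : Set (Measure X)} {ω u : ℝ} {d : ℕ}
    (hd : dimDE Φ D ω ≤ d) (hu : ω ≤ u) (hu0 : 0 ≤ u) (φ : ℕ → X → ℝ) (μ : ℕ → Measure X)
    (I : Finset ℕ) (hφ : ∀ k ∈ I, φ k ∈ Φ) (hμ : ∀ k ∈ I, μ k ∈ D)
    (hlt : ∀ k ∈ I, u < |∫ x, φ k x ∂μ k|)
    (hI : ∀ k ∈ I, ∑ t ∈ I with t < k, (∫ x, φ k x ∂μ t) ^ 2 ≤ u ^ 2) : I.card ≤ d := by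
  have hnat : ((I.card : ℕ) : ℕ∞) ≤ d := by
    refine le_trans ?_ hd
    set g := I.orderEmbOfFin rfl with hg
    let σ : ℕ → ℕ := fun i => if h : i < I.card then g ⟨i, h⟩ else 0
    have hσ : ∀ i (h : i < I.card), σ i = g ⟨i, h⟩ := fun i h => dif_pos h
    have hσI : ∀ i < I.card, σ i ∈ I := fun i h => by
      rw [hσ i h]
      exact Finset.orderEmbOfFin_mem _ _ _
    refine le_iSup₂_of_le I.card ⟨fun i => μ (σ i), fun i hi => hμ _ (hσI i hi), u, hu, ?_⟩ le_rfl
    intro i hi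
    refine ⟨φ (σ i), hφ _ (hσI i hi), ?_, hlt _ (hσI i hi)⟩
    refine Real.sqrt_le_iff.mpr ⟨hu0, le_trans (le_of_eq ?_) (hI _ (hσI i hi))⟩
    symm
    refine Finset.sum_nbij' (i := fun t => ((I.orderIsoOfFin rfl).symm
      (if h : t ∈ I then ⟨t, h⟩ else ⟨σ i, hσI i hi⟩) : Fin I.card).1) (j := σ) ?_ ?_ ?_ ?_ ?_
    · intro t ht
      obtain ⟨htI, hlt⟩ := Finset.mem_filter.mp ht
      rw [dif_pos htI, Finset.mem_range]
      have : (I.orderIsoOfFin rfl).symm ⟨t, htI⟩ < ⟨i, hi⟩ := by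
        rw [OrderIso.symm_apply_lt]
        rw [hσ i hi] at hlt
        exact hlt
      exact this
    · intro j hj
      have hj := Finset.mem_range.mp hj
      refine Finset.mem_filter.mpr ⟨hσI j (hj.trans hi), ?_⟩
      rw [hσ i hi, hσ j (hj.trans hi)]
      exact g.strictMono hj
    · intro t ht
      obtain ⟨htI, hlt⟩ := Finset.mem_filter.mp ht
      rw [dif_pos htI, hσ _ (Fin.is_lt _)]
      have := (I.orderIsoOfFin rfl).apply_symm_apply ⟨t, htI⟩
      exact congrArg Subtype.val this
    · intro j hj
      have hj := Finset.mem_range.mp hj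
      rw [dif_pos (hσI j (hj.trans hi))]
      have : (⟨σ j, hσI j (hj.trans hi)⟩ : I) = I.orderIsoOfFin rfl ⟨j, hj.trans hi⟩ :=
        Subtype.ext (hσ j (hj.trans hi))
      rw [this, OrderIso.symm_apply_apply]
    · intro t ht
      obtain ⟨htI, hlt⟩ := Finset.mem_filter.mp ht
      beta_reduce
      rw [dif_pos htI, hσ _ (Fin.is_lt _)]
      have := congrArg Subtype.val ((I.orderIsoOfFin rfl).apply_symm_apply ⟨t, htI⟩)
      have h2 : g ((I.orderIsoOfFin rfl).symm ⟨t, htI⟩) = t := this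
      simp only [Fin.eta, h2]
  exact_mod_cast hnat

/-- The distributional Eluder dimension bounds the cumulative error of functions that are small
on the earlier measures. -/
theorem sum_abs_integral_le_of_dimDE {Φ : Set (X → ℝ)} {D : Set (Measure X)} {ω b : ℝ} {d K : ℕ}
    (hω : 0 < ω) (hb : 0 ≤ b) (hd : dimDE Φ D ω ≤ d) (φ : ℕ → X → ℝ) (μ : ℕ → Measure X)
    (hφ : ∀ k < K, φ k ∈ Φ) (hμ : ∀ k < K, μ k ∈ D) (h1 : ∀ k < K, |∫ x, φ k x ∂μ k| ≤ 1)
    (hsum : ∀ k < K, ∑ t ∈ Finset.range k, (∫ x, φ k x ∂μ t) ^ 2 ≤ b) :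
    ∑ k ∈ Finset.range K, |∫ x, φ k x ∂μ k| ≤ K * ω + d + 2 * √(d * b * K) := by
  set e : ℕ → ℝ := fun k => |∫ x, φ k x ∂μ k| with he
  set T := (Finset.range K).filter fun k => ω < e k with hT
  have hTK : ∀ k ∈ T, k < K := fun k hk => Finset.mem_range.mp (Finset.mem_filter.mp hk).1
  have hmain : ∑ k ∈ T, e k ≤ d + 2 * √(d * b * T.card) := by
    refine sum_le_of_count_le e ω b d hω hb T (fun k hk => h1 k (hTK k hk))
      (fun k hk => (Finset.mem_filter.mp hk).2) ?_
    intro u hu T' hT' hlt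
    have hu0 : 0 < u := hω.trans_le hu
    have hT'K : ∀ k ∈ T', k < K := fun k hk => hTK k (hT' hk)
    -- The number of rounds is a natural `n` with `b < n u²`, as the strict bound of
    -- `card_le_mul_of_sum_lt` requires.
    have hcard : T'.card ≤ (⌊b / u ^ 2⌋₊ + 1) * d := by
      refine card_le_mul_of_sum_lt (fun t k => (∫ x, φ k x ∂μ t) ^ 2) (u ^ 2) d
        (fun _ _ => sq_nonneg _) _ T' ?_ ?_
      · intro I hI hind
        exact card_le_of_independent hd hu hu0.le φ μ I (fun k hk => hφ k (hT'K k (hI hk)))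
          (fun k hk => hμ k (hT'K k (hI hk))) (fun k hk => hlt k (hI hk)) hind
      · intro k hk
        have h2 : ∑ t ∈ T' with t < k, (∫ x, φ k x ∂μ t) ^ 2
            ≤ ∑ t ∈ Finset.range k, (∫ x, φ k x ∂μ t) ^ 2 := by
          refine Finset.sum_le_sum_of_subset_of_nonneg ?_ fun _ _ _ => sq_nonneg _
          intro t ht
          exact Finset.mem_range.mpr (Finset.mem_filter.mp ht).2
        have h3 := hsum k (hT'K k hk)
        have h4 : b / u ^ 2 < (⌊b / u ^ 2⌋₊ + 1 : ℕ) := by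
          push_cast
          exact Nat.lt_floor_add_one _
        rw [div_lt_iff₀ (by positivity)] at h4
        linarith
    have h5 : ((⌊b / u ^ 2⌋₊ : ℕ) : ℝ) ≤ b / u ^ 2 := Nat.floor_le (by positivity)
    calc (T'.card : ℝ) ≤ ((⌊b / u ^ 2⌋₊ + 1) * d : ℕ) := by exact_mod_cast hcard
      _ = d * ((⌊b / u ^ 2⌋₊ : ℕ) + 1) := by push_cast; ring
      _ ≤ d * (b / u ^ 2 + 1) := by gcongr
  have hcardK : (T.card : ℝ) ≤ K := by
    have := Finset.card_filter_le (Finset.range K) fun k => ω < e k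
    rw [Finset.card_range] at this
    exact_mod_cast this
  have hrest : ∑ k ∈ Finset.range K with ¬ ω < e k, e k ≤ K * ω := by
    calc ∑ k ∈ Finset.range K with ¬ ω < e k, e k
        ≤ ∑ k ∈ Finset.range K with ¬ ω < e k, ω :=
          Finset.sum_le_sum fun k hk => not_lt.mp (Finset.mem_filter.mp hk).2
      _ ≤ ∑ k ∈ Finset.range K, ω :=
          Finset.sum_le_sum_of_subset_of_nonneg (Finset.filter_subset _ _) fun _ _ _ => hω.le
      _ = K * ω := by simp
  rw [← Finset.sum_filter_add_sum_filter_not (Finset.range K) (fun k => ω < e k)]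
  have h6 : √(d * b * T.card) ≤ √(d * b * K) := Real.sqrt_le_sqrt (by gcongr)
  linarith

end EluderSum

/-! ### Integrals of bounded functions. -/

section Integrals

variable {α β : Type*} [MeasurableSpace α] [MeasurableSpace β]

theorem integral_bind_of_mem_Icc {μ : Measure α} [IsProbabilityMeasure μ] (κ : Kernel α β)
    [IsMarkovKernel κ] {f : β → ℝ} {a b : ℝ} (hf : Measurable f) (hab : ∀ y, f y ∈ Set.Icc a b) :
    ∫ y, f y ∂(μ.bind κ) = ∫ x, ∫ y, f y ∂(κ x) ∂μ := by
  have h : Integrable f ((κ ∘ₖ Kernel.const Unit μ) ()) :=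
    Integrable.of_mem_Icc a b hf.aemeasurable (ae_of_all _ hab)
  have h2 := Kernel.integral_comp h
  rwa [Kernel.comp_apply, Kernel.const_apply] at h2

theorem integral_mem_Icc {μ : Measure α} [IsProbabilityMeasure μ] {f : α → ℝ} {a b : ℝ}
    (hf : AEMeasurable f μ) (hab : ∀ x, f x ∈ Set.Icc a b) : ∫ x, f x ∂μ ∈ Set.Icc a b := by
  have hi : Integrable f μ := Integrable.of_mem_Icc a b hf (ae_of_all _ hab)
  constructor
  · calc a = ∫ _, a ∂μ := by simp
      _ ≤ _ := integral_mono (integrable_const _) hi fun x => (hab x).1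
  · calc ∫ x, f x ∂μ ≤ ∫ _, b ∂μ := integral_mono hi (integrable_const _) fun x => (hab x).2
      _ = b := by simp

theorem abs_integral_sub_le {μ : Measure α} [IsProbabilityMeasure μ] {f g : α → ℝ} {η : ℝ}
    (hf : Integrable f μ) (hg : Integrable g μ) (h : ∀ x, |f x - g x| ≤ η) :
    |∫ x, f x ∂μ - ∫ x, g x ∂μ| ≤ η := by
  rw [← integral_sub hf hg]
  have := norm_integral_le_of_norm_le_const (μ := μ) (f := fun x => f x - g x) (C := η)
    (ae_of_all _ h)
  simpa using this

/-- Nonnegativity of the variance. It passes from the expected squares supplied by concentration to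
the squared expectations in the Eluder dimension. -/
theorem sq_integral_le {μ : Measure α} [IsProbabilityMeasure μ] {f : α → ℝ}
    (hf : AEMeasurable f μ) (h1 : ∀ x, |f x| ≤ 1) : (∫ x, f x ∂μ) ^ 2 ≤ ∫ x, f x ^ 2 ∂μ := by
  have hi : Integrable f μ := Integrable.of_bound hf.aestronglyMeasurable 1 (ae_of_all _ h1)
  have hi2 : Integrable (fun x => f x ^ 2) μ :=
    Integrable.of_bound (hf.pow_const 2).aestronglyMeasurable 1 (ae_of_all _ fun x => by
      rw [Real.norm_eq_abs, abs_pow]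
      exact pow_le_one₀ (abs_nonneg _) (h1 x))
  set m := ∫ x, f x ∂μ with hm
  have h0 : 0 ≤ ∫ x, (f x ^ 2 - 2 * m * f x + m ^ 2) ∂μ :=
    integral_nonneg fun x => by
      have := sq_nonneg (f x - m)
      simp only [Pi.zero_apply]
      nlinarith
  have hi3 : Integrable (fun x => 2 * m * f x) μ := hi.const_mul _
  have hi4 : Integrable (fun x => f x ^ 2 - 2 * m * f x) μ := hi2.sub hi3
  rw [integral_add hi4 (integrable_const _),
    integral_sub hi2 hi3, integral_const_mul, ← hm] at h0
  simp only [integral_const, probReal_univ, smul_eq_mul, one_mul] at h0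
  nlinarith

end Integrals

/-! ### State laws and the Bellman equation of a fixed policy. -/

section Policies

variable {S A : Type*} [MeasurableSpace S] [MeasurableSpace A] {M : MDP S A} {π : ℕ → S → A}

instance (M : MDP S A) (h : ℕ) : IsMarkovKernel (M.P h) := M.markov h

/-- The transition kernel of the states at step `h` under the policy `π`. -/
def policyKernel (M : MDP S A) {π : ℕ → S → A} (hπ : ∀ h, Measurable (π h)) (h : ℕ) : Kernel S S :=
  (M.P h).comap (fun x => (x, π h x)) (measurable_id.prodMk (hπ h))

instance (hπ : ∀ h, Measurable (π h)) (h : ℕ) : IsMarkovKernel (policyKernel M hπ h) := by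
  unfold policyKernel
  infer_instance

theorem coe_policyKernel (hπ : ∀ h, Measurable (π h)) (h : ℕ) :
    (fun x => M.P h (x, π h x)) = policyKernel M hπ h := rfl

theorem measurable_stateLaw (hπ : ∀ h, Measurable (π h)) (h n : ℕ) :
    Measurable fun s => stateLaw M π h s n := by
  induction n with
  | zero => exact Measure.measurable_dirac
  | succ n ih =>
    simp only [stateLaw]
    exact (Measure.measurable_bind' (policyKernel M hπ (h + n)).measurable).comp ih

theorem isProbabilityMeasure_stateLaw (hπ : ∀ h, Measurable (π h)) (h : ℕ) (s : S) (n : ℕ) :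
    IsProbabilityMeasure (stateLaw M π h s n) := by
  induction n with
  | zero => exact Measure.dirac.isProbabilityMeasure
  | succ n ih =>
    simp only [stateLaw, coe_policyKernel hπ]
    infer_instance

/-- `stateLaw` is defined by appending a last step; the Bellman equation needs the first step split
off. Associativity of `bind` converts one into the other. -/
theorem stateLaw_succ_eq_bind (hπ : ∀ h, Measurable (π h)) (h : ℕ) (s : S) (n : ℕ) :
    stateLaw M π h s (n + 1) =
      (M.P h (s, π h s)).bind fun x => stateLaw M π (h + 1) x n := by
  induction n with
  | zero =>
    have h1 : stateLaw M π h s 1 = (Measure.dirac s).bind (policyKernel M hπ h) := rfl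
    rw [h1, Measure.dirac_bind (policyKernel M hπ h).measurable]
    exact Measure.bind_dirac.symm
  | succ n ih =>
    have h1 : stateLaw M π h s (n + 1 + 1)
        = (stateLaw M π h s (n + 1)).bind (policyKernel M hπ (h + (n + 1))) := rfl
    rw [h1, ih, Measure.bind_bind (measurable_stateLaw hπ _ _).aemeasurable
      (Kernel.aemeasurable _), show h + (n + 1) = h + 1 + n by omega]
    rfl

/-- The kernel `s ↦ law of s_{h+n}`. -/
def stateKernel (M : MDP S A) {π : ℕ → S → A} (hπ : ∀ h, Measurable (π h)) (h n : ℕ) :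
    Kernel S S :=
  ⟨fun s => stateLaw M π h s n, measurable_stateLaw hπ h n⟩

instance (hπ : ∀ h, Measurable (π h)) (h n : ℕ) : IsMarkovKernel (stateKernel M hπ h n) :=
  ⟨fun s => isProbabilityMeasure_stateLaw hπ h s n⟩

theorem measurable_reward_policy (hπ : ∀ h, Measurable (π h)) (h : ℕ) :
    Measurable fun x => M.r h (x, π h x) :=
  (M.measurable_r h).comp (measurable_id.prodMk (hπ h))

theorem measurable_value (hπ : ∀ h, Measurable (π h)) (h : ℕ) : Measurable (value M π h) := by
  unfold value
  refine Finset.measurable_fun_sum _ fun n _ => ?_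
  have : StronglyMeasurable fun s => ∫ x, M.r (h + n) (x, π (h + n) x) ∂stateKernel M hπ h n s :=
    StronglyMeasurable.integral_kernel_prod_right
      (f := fun _ x => M.r (h + n) (x, π (h + n) x))
      ((measurable_reward_policy hπ _).comp measurable_snd).stronglyMeasurable
  exact this.measurable

variable (hr : ∀ h < M.H, ∀ x, M.r h x ≤ 1)
include hr

theorem value_mem_Icc (hπ : ∀ h, Measurable (π h)) (h : ℕ) (s : S) :
    value M π h s ∈ Set.Icc (0 : ℝ) M.H := by
  have key : ∀ n ∈ Finset.range (M.H - h),
      ∫ x, M.r (h + n) (x, π (h + n) x) ∂(stateLaw M π h s n) ∈ Set.Icc (0 : ℝ) 1 := by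
    intro n hn
    have := isProbabilityMeasure_stateLaw (M := M) hπ h s n
    have hn := Finset.mem_range.mp hn
    exact integral_mem_Icc (measurable_reward_policy hπ _).aemeasurable
      fun x => ⟨M.r_nonneg _ _, hr _ (by omega) _⟩
  constructor
  · exact Finset.sum_nonneg fun n hn => (key n hn).1
  · calc value M π h s ≤ ∑ n ∈ Finset.range (M.H - h), (1 : ℝ) :=
          Finset.sum_le_sum fun n hn => (key n hn).2
      _ = ((M.H - h : ℕ) : ℝ) := by simp
      _ ≤ M.H := by exact_mod_cast Nat.sub_le _ _

theorem integrable_value (hπ : ∀ h, Measurable (π h)) (h : ℕ) (μ : Measure S)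
    [IsFiniteMeasure μ] : Integrable (value M π h) μ :=
  Integrable.of_mem_Icc 0 M.H (measurable_value hπ h).aemeasurable
    (ae_of_all _ (value_mem_Icc hr hπ h))

theorem value_eq_qValue (hπ : ∀ h, Measurable (π h)) {h : ℕ} (hh : h < M.H) (s : S) :
    value M π h s = qValue M π h (s, π h s) := by
  unfold qValue
  have h1 : M.H - h = (M.H - (h + 1)) + 1 := by omega
  rw [value, h1, Finset.sum_range_succ', add_comm]
  congr 1
  · exact integral_dirac' _ _ (measurable_reward_policy hπ _).stronglyMeasurable
  · unfold value
    have hmem : ∀ n ∈ Finset.range (M.H - (h + 1)), ∀ x,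
        M.r (h + 1 + n) (x, π (h + 1 + n) x) ∈ Set.Icc (0 : ℝ) 1 := fun n hn x =>
      ⟨M.r_nonneg _ _, hr _ (by have := Finset.mem_range.mp hn; omega) _⟩
    rw [integral_finsetSum]
    · refine Finset.sum_congr rfl fun n hn => ?_
      rw [show h + (n + 1) = h + 1 + n by omega, stateLaw_succ_eq_bind hπ]
      exact integral_bind_of_mem_Icc (stateKernel M hπ (h + 1) n)
        (measurable_reward_policy hπ _) (hmem n hn)
    · intro n hn
      refine Integrable.of_mem_Icc 0 1 ?_ (ae_of_all _ fun s' => ?_)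
      · have : StronglyMeasurable fun s => ∫ x, M.r (h + 1 + n) (x, π (h + 1 + n) x)
            ∂stateKernel M hπ (h + 1) n s :=
          StronglyMeasurable.integral_kernel_prod_right
            (f := fun _ x => M.r (h + 1 + n) (x, π (h + 1 + n) x))
            ((measurable_reward_policy hπ _).comp measurable_snd).stronglyMeasurable
        exact this.measurable.aemeasurable
      · have := isProbabilityMeasure_stateLaw (M := M) hπ (h + 1) s' n
        exact integral_mem_Icc (measurable_reward_policy hπ _).aemeasurable (hmem n hn)

theorem qValue_le (hπ : ∀ h, Measurable (π h)) {h : ℕ} (hh : h < M.H) (x : S × A) :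
    qValue M π h x ≤ 1 + M.H :=
  add_le_add (hr h hh x)
    (integral_mem_Icc (measurable_value hπ _).aemeasurable (value_mem_Icc hr hπ _)).2

theorem qValue_le_qStar (hπ : ∀ h, Measurable (π h)) {h : ℕ} (hh : h < M.H) (x : S × A) :
    qValue M π h x ≤ qStar M h x :=
  le_ciSup (f := fun π : Policy S A => qValue M π.1 h x)
    ⟨1 + M.H, by rintro _ ⟨π, rfl⟩; exact qValue_le hr π.2 hh x⟩ ⟨π, hπ⟩

end Policies

/-! ### Bellman optimality and the decomposition of the optimistic error. -/

section

variable {S A : Type*} [MeasurableSpace S] [MeasurableSpace A] {M : MDP S A}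
  {F G : ℕ → Set (S × A → ℝ)} {greedy : QTuple S A → ℕ → S → A}

/-- The standing assumptions on the classes: bounded measurable functions, greedy policies,
realizability and completeness. -/
structure Setting (M : MDP S A) (F G : ℕ → Set (S × A → ℝ))
    (greedy : QTuple S A → ℕ → S → A) : Prop where
  pos : 0 < M.H
  classF : IsFunctionClass M.H F
  classG : IsFunctionClass M.H G
  greedyRule : IsGreedyRule M.H F greedy
  realizable : Realizable M F
  complete : Complete M F G

/-- The tuple `Q*`, continued by `0` after the last step. -/
def qStarTuple (M : MDP S A) : QTuple S A := fun h => if h < M.H then qStar M h else 0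

/-- The Bellman residual `f_h - T_h f_{h+1}`. -/
def residual (M : MDP S A) (f : QTuple S A) (h : ℕ) (x : S × A) : ℝ :=
  f h x - bellman M h (f (h + 1)) x

namespace Setting

theorem nonempty_action (_ : Setting M F G greedy) : Nonempty A := ⟨greedy 0 0 M.s₁⟩

variable (hs : Setting M F G greedy)
include hs

theorem qStarTuple_mem : qStarTuple M ∈ tuples M.H F := by
  intro h
  unfold qStarTuple withTerminal
  split_ifs with hh
  · exact hs.realizable h hh
  · rfl

theorem measurable_greedy {f : QTuple S A} (hf : f ∈ tuples M.H F) (h : ℕ) :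
    Measurable (greedy f h) := (hs.greedyRule f hf).1 h

theorem measurable_and_mem_Icc {f : QTuple S A} (hf : f ∈ tuples M.H F) (h : ℕ) :
    Measurable (f h) ∧ ∀ x, f h x ∈ Set.Icc (0 : ℝ) 1 := by
  have := hf h
  unfold withTerminal at this
  split_ifs at this with hh
  · exact hs.classF h hh _ this
  · rw [Set.mem_singleton_iff] at this
    rw [this]
    exact ⟨measurable_const, fun x => by simp⟩

/-- The greedy action attains the maximum, and beyond the horizon both sides vanish. This also gives
measurability of the supremum, which is not automatic over an uncountable action space. -/
theorem iSup_eq_greedy {f : QTuple S A} (hf : f ∈ tuples M.H F) (h : ℕ) (s : S) :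
    ⨆ a, f h (s, a) = f h (s, greedy f h s) := by
  have := hs.nonempty_action
  by_cases hh : h < M.H
  · refine le_antisymm (ciSup_le ((hs.greedyRule f hf).2 h hh s)) ?_
    exact le_ciSup (f := fun a => f h (s, a))
      ⟨1, by rintro _ ⟨a, rfl⟩; exact ((hs.measurable_and_mem_Icc hf h).2 _).2⟩ _
  · have h0 := hf h
    unfold withTerminal at h0
    rw [if_neg hh, Set.mem_singleton_iff] at h0
    simp [h0]

theorem measurable_iSup {f : QTuple S A} (hf : f ∈ tuples M.H F) (h : ℕ) :
    Measurable fun s => ⨆ a, f h (s, a) := by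
  simp_rw [hs.iSup_eq_greedy hf]
  exact (hs.measurable_and_mem_Icc hf h).1.comp
    (measurable_id.prodMk (hs.measurable_greedy hf h))

theorem iSup_mem_Icc {f : QTuple S A} (hf : f ∈ tuples M.H F) (h : ℕ) (s : S) :
    ⨆ a, f h (s, a) ∈ Set.Icc (0 : ℝ) 1 := by
  rw [hs.iSup_eq_greedy hf]
  exact (hs.measurable_and_mem_Icc hf h).2 _

theorem abs_iSup_sub_le {f f' : QTuple S A} (hf : f ∈ tuples M.H F) (hf' : f' ∈ tuples M.H F)
    {h : ℕ} {η : ℝ} (hη : ∀ x, |f h x - f' h x| ≤ η) (s : S) :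
    |(⨆ a, f h (s, a)) - ⨆ a, f' h (s, a)| ≤ η := by
  have := hs.nonempty_action
  have key : ∀ {f f' : QTuple S A}, f ∈ tuples M.H F → f' ∈ tuples M.H F →
      (∀ x, |f h x - f' h x| ≤ η) → ⨆ a, f h (s, a) ≤ (⨆ a, f' h (s, a)) + η := by
    intro f f' hf hf' hη
    refine ciSup_le fun a => ?_
    have h1 : f' h (s, a) ≤ ⨆ a, f' h (s, a) := le_ciSup (f := fun a => f' h (s, a))
      ⟨1, by rintro _ ⟨a, rfl⟩; exact ((hs.measurable_and_mem_Icc hf' h).2 _).2⟩ a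
    have h2 := (abs_le.mp (hη (s, a))).2
    linarith
  have h1 := key hf hf' hη
  have h2 := key hf' hf fun x => by rw [abs_sub_comm]; exact hη x
  exact abs_le.mpr ⟨by linarith, by linarith⟩

theorem bellman_mem {f : QTuple S A} (hf : f ∈ tuples M.H F) {h : ℕ} (hh : h < M.H) :
    bellman M h (f (h + 1)) ∈ G h := hs.complete h hh _ (hf (h + 1))

theorem bellman_mem_Icc {f : QTuple S A} (hf : f ∈ tuples M.H F) {h : ℕ} (hh : h < M.H)
    (x : S × A) : bellman M h (f (h + 1)) x ∈ Set.Icc (0 : ℝ) 1 :=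
  (hs.classG h hh _ (hs.bellman_mem hf hh)).2 x

theorem measurable_bellman {f : QTuple S A} (hf : f ∈ tuples M.H F) {h : ℕ} (hh : h < M.H) :
    Measurable (bellman M h (f (h + 1))) := (hs.classG h hh _ (hs.bellman_mem hf hh)).1

theorem integrable_iSup {f : QTuple S A} (hf : f ∈ tuples M.H F) (h : ℕ) (μ : Measure S)
    [IsFiniteMeasure μ] : Integrable (fun s => ⨆ a, f h (s, a)) μ :=
  Integrable.of_mem_Icc 0 1 (hs.measurable_iSup hf h).aemeasurable
    (ae_of_all _ (hs.iSup_mem_Icc hf h))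

theorem abs_bellman_sub_le {f f' : QTuple S A} (hf : f ∈ tuples M.H F) (hf' : f' ∈ tuples M.H F)
    {h : ℕ} {η : ℝ} (hη : ∀ x, |f (h + 1) x - f' (h + 1) x| ≤ η) (x : S × A) :
    |bellman M h (f (h + 1)) x - bellman M h (f' (h + 1)) x| ≤ η := by
  unfold bellman
  rw [add_sub_add_left_eq_sub]
  exact abs_integral_sub_le (hs.integrable_iSup hf _ _) (hs.integrable_iSup hf' _ _)
    (hs.abs_iSup_sub_le hf hf' hη)

/-- By completeness `T_h Q*_{h+1}` lies in `G_h`, hence is at most one, and it is the reward plus a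
nonnegative expectation. The bound makes the value integrals and the suprema over policies genuine
rather than default values. -/
theorem reward_le_one : ∀ h < M.H, ∀ x, M.r h x ≤ 1 := by
  intro h hh x
  have h1 := (hs.bellman_mem_Icc hs.qStarTuple_mem hh x).2
  have h2 : 0 ≤ ∫ s', (⨆ a', qStarTuple M (h + 1) (s', a')) ∂(M.P h x) :=
    integral_nonneg fun s => (hs.iSup_mem_Icc hs.qStarTuple_mem _ s).1
  unfold bellman at h1
  linarith

theorem measurable_residual {f : QTuple S A} (hf : f ∈ tuples M.H F) {h : ℕ} (hh : h < M.H) :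
    Measurable (residual M f h) :=
  (hs.measurable_and_mem_Icc hf h).1.sub (hs.measurable_bellman hf hh)

theorem residual_mem_Icc {f : QTuple S A} (hf : f ∈ tuples M.H F) {h : ℕ} (hh : h < M.H)
    (x : S × A) : residual M f h x ∈ Set.Icc (-1 : ℝ) 1 := by
  have h1 := (hs.measurable_and_mem_Icc hf h).2 x
  have h2 := hs.bellman_mem_Icc hf hh x
  unfold residual
  exact ⟨by linarith [h1.1, h2.2], by linarith [h1.2, h2.1]⟩

theorem abs_residual_le {f : QTuple S A} (hf : f ∈ tuples M.H F) {h : ℕ} (hh : h < M.H)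
    (x : S × A) : |residual M f h x| ≤ 1 := abs_le.mpr (hs.residual_mem_Icc hf hh x)

theorem value_le_iSup_qStar (π : Policy S A) (h : ℕ) (s : S) :
    value M π.1 h s ≤ ⨆ a, qStarTuple M h (s, a) := by
  by_cases hh : h < M.H
  · rw [value_eq_qValue hs.reward_le_one π.2 hh]
    refine (qValue_le_qStar hs.reward_le_one π.2 hh _).trans ?_
    have h1 : qStar M h (s, π.1 h s) = qStarTuple M h (s, π.1 h s) := by
      rw [qStarTuple, if_pos hh]
    rw [h1]
    exact le_ciSup (f := fun a => qStarTuple M h (s, a))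
      ⟨1, by
        rintro _ ⟨a, rfl⟩
        exact ((hs.measurable_and_mem_Icc hs.qStarTuple_mem h).2 _).2⟩ _
  · have h1 : M.H - h = 0 := by omega
    simp only [value, h1, Finset.sum_range_zero]
    exact (hs.iSup_mem_Icc hs.qStarTuple_mem h s).1

theorem qStar_le_bellman {h : ℕ} (hh : h < M.H) (x : S × A) :
    qStarTuple M h x ≤ bellman M h (qStarTuple M (h + 1)) x := by
  rw [qStarTuple, if_pos hh]
  have : Nonempty (Policy S A) :=
    ⟨⟨greedy (qStarTuple M), hs.measurable_greedy hs.qStarTuple_mem⟩⟩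
  refine ciSup_le fun π => ?_
  refine add_le_add le_rfl ?_
  exact integral_mono (integrable_value hs.reward_le_one π.2 _ _)
    (hs.integrable_iSup hs.qStarTuple_mem _ _) fun s => hs.value_le_iSup_qStar π _ s

/-- Backward induction on the number of remaining steps: `Q* ≤ T Q*` at the greedy action, and the
induction hypothesis bounds the maximum of `Q*` at the next state by the value of the greedy policy
there. -/
theorem iSup_qStar_le_value (n : ℕ) : ∀ h, M.H - h = n → ∀ s,
    ⨆ a, qStarTuple M h (s, a) ≤ value M (greedy (qStarTuple M)) h s := by
  have hπ := hs.measurable_greedy hs.qStarTuple_mem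
  have hr := hs.reward_le_one
  induction n with
  | zero =>
    intro h hn s
    rw [hs.iSup_eq_greedy hs.qStarTuple_mem, qStarTuple, if_neg (by omega)]
    exact (value_mem_Icc hr hπ h s).1
  | succ n ih =>
    intro h hn s
    have hh : h < M.H := by omega
    rw [hs.iSup_eq_greedy hs.qStarTuple_mem, value_eq_qValue hr hπ hh]
    refine (hs.qStar_le_bellman hh _).trans (add_le_add le_rfl ?_)
    exact integral_mono (hs.integrable_iSup hs.qStarTuple_mem _ _) (integrable_value hr hπ _ _)
      fun s => ih (h + 1) (by omega) s

/-- The Bellman optimality equation. -/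
theorem bellman_qStar {h : ℕ} (hh : h < M.H) :
    bellman M h (qStarTuple M (h + 1)) = qStarTuple M h := by
  have hπ := hs.measurable_greedy hs.qStarTuple_mem
  have hr := hs.reward_le_one
  ext x
  refine le_antisymm ?_ (hs.qStar_le_bellman hh x)
  rw [qStarTuple, qStarTuple, if_pos hh]
  refine le_trans ?_ (qValue_le_qStar hr hπ hh x)
  refine add_le_add le_rfl ?_
  exact integral_mono (hs.integrable_iSup hs.qStarTuple_mem _ _) (integrable_value hr hπ _ _)
    fun s => hs.iSup_qStar_le_value _ (h + 1) rfl s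

theorem vStar_le : vStar M 0 M.s₁
    ≤ qStarTuple M 0 (M.s₁, greedy (qStarTuple M) 0 M.s₁) := by
  have : Nonempty (Policy S A) :=
    ⟨⟨greedy (qStarTuple M), hs.measurable_greedy hs.qStarTuple_mem⟩⟩
  rw [← hs.iSup_eq_greedy hs.qStarTuple_mem]
  exact ciSup_le fun π => hs.value_le_iSup_qStar π 0 M.s₁

theorem vStar_le_one : vStar M 0 M.s₁ ≤ 1 :=
  hs.vStar_le.trans ((hs.measurable_and_mem_Icc hs.qStarTuple_mem 0).2 _).2

theorem value_le_vStar {π : ℕ → S → A} (hπ : ∀ h, Measurable (π h)) :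
    value M π 0 M.s₁ ≤ vStar M 0 M.s₁ :=
  le_ciSup (f := fun π : Policy S A => value M π.1 0 M.s₁)
    ⟨M.H, by rintro _ ⟨π, rfl⟩; exact (value_mem_Icc hs.reward_le_one π.2 _ _).2⟩ ⟨π, hπ⟩

omit hs in
theorem integral_occupancy {π : ℕ → S → A} (hπ : ∀ h, Measurable (π h)) (h : ℕ)
    {g : S × A → ℝ} (hg : Measurable g) :
    ∫ x, g x ∂(occupancy M π h) = ∫ s, g (s, π h s) ∂(stateLaw M π 0 M.s₁ h) :=
  integral_map (measurable_id.prodMk (hπ h)).aemeasurable hg.aestronglyMeasurable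

omit hs in
theorem isProbabilityMeasure_occupancy {π : ℕ → S → A} (hπ : ∀ h, Measurable (π h)) (h : ℕ) :
    IsProbabilityMeasure (occupancy M π h) := by
  have := isProbabilityMeasure_stateLaw (M := M) hπ 0 M.s₁ h
  exact Measure.isProbabilityMeasure_map (measurable_id.prodMk (hπ h)).aemeasurable

/-- The maximum inside `T_h f_{h+1}` is attained by the same policy that generates the next state,
so the residual becomes a difference of consecutive terms minus the reward, ready to telescope. -/
theorem integral_residual {f : QTuple S A} (hf : f ∈ tuples M.H F) {h : ℕ} (hh : h < M.H) :
    ∫ x, residual M f h x ∂(occupancy M (greedy f) h)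
      = ∫ s, f h (s, greedy f h s) ∂(stateLaw M (greedy f) 0 M.s₁ h)
        - ∫ s, M.r h (s, greedy f h s) ∂(stateLaw M (greedy f) 0 M.s₁ h)
        - ∫ s, f (h + 1) (s, greedy f (h + 1) s) ∂(stateLaw M (greedy f) 0 M.s₁ (h + 1)) := by
  have hπ := hs.measurable_greedy hf
  have := isProbabilityMeasure_stateLaw (M := M) hπ 0 M.s₁ h
  rw [integral_occupancy hπ h (hs.measurable_residual hf hh)]
  have h1 : ∫ s, f (h + 1) (s, greedy f (h + 1) s) ∂(stateLaw M (greedy f) 0 M.s₁ (h + 1))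
      = ∫ s, ∫ s', (⨆ a', f (h + 1) (s', a')) ∂(M.P h (s, greedy f h s))
        ∂(stateLaw M (greedy f) 0 M.s₁ h) := by
    simp_rw [← hs.iSup_eq_greedy hf]
    have h2 : stateLaw M (greedy f) 0 M.s₁ (h + 1)
        = (stateLaw M (greedy f) 0 M.s₁ h).bind (policyKernel M hπ h) := by
      simp only [stateLaw, zero_add]
      rfl
    rw [h2, integral_bind_of_mem_Icc _ (hs.measurable_iSup hf _) (hs.iSup_mem_Icc hf _)]
    rfl
  have hpair : Measurable fun s => (s, greedy f h s) := measurable_id.prodMk (hπ h)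
  have i1 : Integrable (fun s => f h (s, greedy f h s)) (stateLaw M (greedy f) 0 M.s₁ h) :=
    Integrable.of_mem_Icc 0 1 ((hs.measurable_and_mem_Icc hf h).1.comp hpair).aemeasurable
      (ae_of_all _ fun s => (hs.measurable_and_mem_Icc hf h).2 _)
  have i2 : Integrable (fun s => M.r h (s, greedy f h s)) (stateLaw M (greedy f) 0 M.s₁ h) :=
    Integrable.of_mem_Icc 0 1 ((M.measurable_r h).comp hpair).aemeasurable
      (ae_of_all _ fun s => ⟨M.r_nonneg _ _, hs.reward_le_one h hh _⟩)
  have i3 : Integrable (fun s => bellman M h (f (h + 1)) (s, greedy f h s))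
      (stateLaw M (greedy f) 0 M.s₁ h) :=
    Integrable.of_mem_Icc 0 1 ((hs.measurable_bellman hf hh).comp hpair).aemeasurable
      (ae_of_all _ fun s => hs.bellman_mem_Icc hf hh _)
  have h3 : ∀ s, ∫ s', (⨆ a', f (h + 1) (s', a')) ∂(M.P h (s, greedy f h s))
      = bellman M h (f (h + 1)) (s, greedy f h s) - M.r h (s, greedy f h s) := fun s => by
    unfold bellman
    ring
  rw [h1]
  simp_rw [h3]
  rw [integral_sub i3 i2]
  simp only [residual]
  rw [integral_sub i1 i3]
  ring

/-- The optimistic estimate exceeds the value of the greedy policy by the expected Bellman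
residuals along that policy. -/
theorem sub_value_eq_sum_residual {f : QTuple S A} (hf : f ∈ tuples M.H F) :
    f 0 (M.s₁, greedy f 0 M.s₁) - value M (greedy f) 0 M.s₁
      = ∑ h ∈ Finset.range M.H, ∫ x, residual M f h x ∂(occupancy M (greedy f) h) := by
  have hπ := hs.measurable_greedy hf
  have key : ∀ n ≤ M.H, ∑ h ∈ Finset.range n, ∫ x, residual M f h x ∂(occupancy M (greedy f) h)
      = f 0 (M.s₁, greedy f 0 M.s₁)
        - ∑ h ∈ Finset.range n,
            ∫ s, M.r h (s, greedy f h s) ∂(stateLaw M (greedy f) 0 M.s₁ h)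
        - ∫ s, f n (s, greedy f n s) ∂(stateLaw M (greedy f) 0 M.s₁ n) := by
    intro n
    induction n with
    | zero =>
      intro _
      have : ∫ s, f 0 (s, greedy f 0 s) ∂(stateLaw M (greedy f) 0 M.s₁ 0)
          = f 0 (M.s₁, greedy f 0 M.s₁) :=
        integral_dirac' _ _ ((hs.measurable_and_mem_Icc hf 0).1.comp
          (measurable_id.prodMk (hπ 0))).stronglyMeasurable
      simp [this]
    | succ n ih =>
      intro hn
      rw [Finset.sum_range_succ, Finset.sum_range_succ, ih (by omega),
        hs.integral_residual hf (by omega)]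
      ring
  rw [key M.H le_rfl]
  have h0 : f M.H = 0 := by
    have := hf M.H
    unfold withTerminal at this
    rwa [if_neg (lt_irrefl _)] at this
  simp [h0, value]

end Setting

end

/-! ### Integrating out the next state given the past. -/

section Transition

variable {Ω Ω' S α : Type*} [MeasurableSpace S] [MeasurableSpace α]

theorem measurable_slice {m : MeasurableSpace Ω} {g : Ω × S → α} (hg : Measurable g) (ω : Ω) :
    Measurable fun y => g (ω, y) := hg.comp measurable_prodMk_left

/-- Both sides agree on rectangles, which determine a finite measure on the product. A separate
space `Ω'` allows its later use for `Ω` with a smaller `σ`-algebra. -/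
theorem map_prodMk_eq_compProd [MeasurableSpace Ω] [MeasurableSpace Ω'] {Pr : Measure Ω}
    [IsProbabilityMeasure Pr] {T : Ω → Ω'} (hT : Measurable T) {X : Ω → S} (hX : Measurable X)
    (κ : Kernel Ω' S) [IsMarkovKernel κ]
    (htr : ∀ E : Set Ω', MeasurableSet E → ∀ B : Set S, MeasurableSet B →
      Pr (T ⁻¹' E ∩ X ⁻¹' B) = ∫⁻ ω in T ⁻¹' E, κ (T ω) B ∂Pr) :
    Pr.map (fun ω => (T ω, X ω)) = (Pr.map T).compProd κ := by
  have : IsProbabilityMeasure (Pr.map fun ω => (T ω, X ω)) :=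
    Measure.isProbabilityMeasure_map (hT.prodMk hX).aemeasurable
  refine Measure.ext_prod fun {E B} hE hB => ?_
  rw [Measure.map_apply (hT.prodMk hX) (hE.prod hB), Measure.compProd_apply_prod hE hB,
    setLIntegral_map hE (κ.measurable_coe hB) hT, ← htr E hE B hB]
  rfl

theorem lintegral_prodMk_eq [MeasurableSpace Ω] [MeasurableSpace Ω'] {Pr : Measure Ω}
    [IsProbabilityMeasure Pr] {T : Ω → Ω'} (hT : Measurable T) {X : Ω → S} (hX : Measurable X)
    (κ : Kernel Ω' S) [IsMarkovKernel κ]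
    (htr : ∀ E : Set Ω', MeasurableSet E → ∀ B : Set S, MeasurableSet B →
      Pr (T ⁻¹' E ∩ X ⁻¹' B) = ∫⁻ ω in T ⁻¹' E, κ (T ω) B ∂Pr)
    {g : Ω' × S → ENNReal} (hg : Measurable g) :
    ∫⁻ ω, g (T ω, X ω) ∂Pr = ∫⁻ ω, ∫⁻ y, g (T ω, y) ∂κ (T ω) ∂Pr := by
  have : IsProbabilityMeasure (Pr.map T) := Measure.isProbabilityMeasure_map hT.aemeasurable
  rw [← lintegral_map hg (hT.prodMk hX), map_prodMk_eq_compProd hT hX κ htr,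
    Measure.lintegral_compProd hg, lintegral_map hg.lintegral_kernel_prod_right' hT]

/-- Integration against the next state, whose conditional law given the `σ`-algebra `m` is
`κ (x ω)`. -/
theorem lintegral_of_transition {m m0 : MeasurableSpace Ω} {Pr : Measure[m0] Ω}
    [IsProbabilityMeasure Pr] (hm : m ≤ m0) {X : Ω → S} (hX : Measurable[m0] X)
    (κ : Kernel α S) [IsMarkovKernel κ] {x : Ω → α} (hx : Measurable[m] x)
    (htr : ∀ E : Set Ω, MeasurableSet[m] E → ∀ B : Set S, MeasurableSet B →
      Pr (E ∩ X ⁻¹' B) = ∫⁻ ω in E, κ (x ω) B ∂Pr)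
    {g : Ω × S → ENNReal} (hg : Measurable[m.prod inferInstance] g) :
    ∫⁻ ω, g (ω, X ω) ∂Pr = ∫⁻ ω, ∫⁻ y, g (ω, y) ∂κ (x ω) ∂Pr := by
  -- Conditioning on `m` is encoded by the identity, seen as a map from `(Ω, m0)` to `(Ω, m)`.
  have hT : @Measurable Ω Ω m0 m id := measurable_id'' hm
  exact @lintegral_prodMk_eq Ω Ω S _ m0 m Pr _ id hT X hX (@Kernel.comap α S _ _ Ω m κ x hx)
    (@Kernel.IsMarkovKernel.comap α S _ _ Ω m x κ _ hx) htr g hg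

end Transition

/-! ### Measurability of expectations under a policy that depends on the outcome. -/

section RandomPolicy

variable {Ω S A : Type*} [MeasurableSpace S] [MeasurableSpace A] {M : MDP S A}

theorem measurable_lintegral_next [MeasurableSpace Ω] {π : Ω → ℕ → S → A} {h : ℕ}
    (hπ : Measurable fun p : Ω × S => π p.1 h p.2) {g : Ω × S → ENNReal} (hg : Measurable g) :
    Measurable fun p : Ω × S => ∫⁻ y, g (p.1, y) ∂M.P h (p.2, π p.1 h p.2) := by
  have hx : Measurable fun p : Ω × S => (p.2, π p.1 h p.2) := measurable_snd.prodMk hπ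
  exact Measurable.lintegral_kernel_prod_right' (κ := (M.P h).comap _ hx)
    (f := fun q : (Ω × S) × S => g (q.1.1, q.2)) (by fun_prop)

theorem lintegral_stateLaw_succ {π : ℕ → S → A} {h : ℕ} (hπ : Measurable (π h)) (s : S)
    {g : S → ENNReal} (hg : Measurable g) :
    ∫⁻ y, g y ∂stateLaw M π 0 s (h + 1)
      = ∫⁻ x, ∫⁻ y, g y ∂M.P h (x, π h x) ∂stateLaw M π 0 s h := by
  simp only [stateLaw, zero_add]
  exact Measure.lintegral_bind
    ((M.P h).measurable.comp (measurable_id.prodMk hπ)).aemeasurable hg.aemeasurable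

/-- The last step is integrated out first: this gives another jointly measurable function of outcome
and state, so the induction runs over all such `g`. -/
theorem measurable_lintegral_stateLaw [MeasurableSpace Ω] {π : Ω → ℕ → S → A}
    (hπ : ∀ h < M.H, Measurable fun p : Ω × S => π p.1 h p.2) (s : S) (n : ℕ) :
    n ≤ M.H → ∀ {g : Ω × S → ENNReal}, Measurable g →
      Measurable fun ω => ∫⁻ y, g (ω, y) ∂stateLaw M (π ω) 0 s n := by
  induction n with
  | zero =>
    intro _ g hg
    have : ∀ ω, ∫⁻ y, g (ω, y) ∂stateLaw M (π ω) 0 s 0 = g (ω, s) := fun ω =>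
      lintegral_dirac' s (hg.comp measurable_prodMk_left)
    simp_rw [this]
    exact hg.comp measurable_prodMk_right
  | succ n ih =>
    intro hn g hg
    have : ∀ ω, ∫⁻ y, g (ω, y) ∂stateLaw M (π ω) 0 s (n + 1)
        = ∫⁻ x, ∫⁻ y, g (ω, y) ∂M.P n (x, π ω n x) ∂stateLaw M (π ω) 0 s n := fun ω =>
      lintegral_stateLaw_succ ((hπ n (by omega)).comp measurable_prodMk_left) s
        (hg.comp measurable_prodMk_left)
    simp_rw [this]
    exact ih (by omega) (measurable_lintegral_next (hπ n (by omega)) hg)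

theorem measurable_integral_stateLaw [MeasurableSpace Ω] {π : Ω → ℕ → S → A}
    (hπ : ∀ h < M.H, Measurable fun p : Ω × S => π p.1 h p.2) (s : S) {n : ℕ}
    (hn : n ≤ M.H) {g : Ω × S → ℝ} (hg : Measurable g) (h0 : ∀ p, 0 ≤ g p) :
    Measurable fun ω => ∫ y, g (ω, y) ∂stateLaw M (π ω) 0 s n := by
  have : ∀ ω, ∫ y, g (ω, y) ∂stateLaw M (π ω) 0 s n
      = (∫⁻ y, ENNReal.ofReal (g (ω, y)) ∂stateLaw M (π ω) 0 s n).toReal := fun ω =>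
    integral_eq_lintegral_of_nonneg_ae (ae_of_all _ fun y => h0 _)
      (hg.comp measurable_prodMk_left).aestronglyMeasurable
  simp_rw [this]
  exact (measurable_lintegral_stateLaw hπ s n hn
    (g := fun p => ENNReal.ofReal (g p)) hg.ennreal_ofReal).ennreal_toReal

end RandomPolicy

/-! ### Laws of the states visited in a run. -/

section Run

variable {Ω S A : Type*} [MeasurableSpace S] [MeasurableSpace A] [mΩ : MeasurableSpace Ω]
  {Pr : Measure Ω} [IsProbabilityMeasure Pr] {M : MDP S A} {F G : ℕ → Set (S × A → ℝ)}
  {greedy : QTuple S A → ℕ → S → A} {K : ℕ} {β : ℝ} {𝓖 : ℕ → ℕ → MeasurableSpace Ω}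
  {s : ℕ → ℕ → Ω → S} {f : ℕ → Ω → QTuple S A}

/-- The state-action pair at step `h` of episode `k`. -/
def visit (greedy : QTuple S A → ℕ → S → A) (s : ℕ → ℕ → Ω → S) (f : ℕ → Ω → QTuple S A)
    (k h : ℕ) (ω : Ω) : S × A :=
  (s k h ω, action greedy s f ω k h)

namespace IsRun

variable (run : IsRun Pr M F G greedy K β 𝓖 s f)
include run

omit [IsProbabilityMeasure Pr] in
theorem mono_within {k : ℕ} (hk : k < K) {i j : ℕ} (hij : i ≤ j) (hj : j ≤ M.H) :
    𝓖 k i ≤ 𝓖 k j := by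
  induction j, hij using Nat.le_induction with
  | base => exact le_rfl
  | succ j _ ih => exact (ih (by omega)).trans (run.mono_step k hk j (by omega))

omit [IsProbabilityMeasure Pr] in
theorem mono_start {k l : ℕ} (hkl : k ≤ l) (hl : l ≤ K) : 𝓖 k 0 ≤ 𝓖 l 0 := by
  induction l, hkl using Nat.le_induction with
  | base => exact le_rfl
  | succ l _ ih =>
    exact (ih (by omega)).trans
      ((run.mono_within (by omega) (Nat.zero_le _) le_rfl).trans (run.mono_episode l (by omega)))

omit [IsProbabilityMeasure Pr] in
theorem le_start {t k j : ℕ} (htk : t < k) (hk : k ≤ K) (hj : j ≤ M.H) : 𝓖 t j ≤ 𝓖 k 0 :=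
  (run.mono_within (by omega) hj le_rfl).trans
    ((run.mono_episode t (by omega)).trans (run.mono_start htk hk))

omit [IsProbabilityMeasure Pr] in
theorem measurable_visit {k h : ℕ} (hk : k < K) (hh : h < M.H) :
    Measurable[𝓖 k h] (visit greedy s f k h) := by
  have h1 := run.measurable_state k hk h hh.le
  have h2 : @Measurable _ _ (𝓖 k h) (@Prod.instMeasurableSpace _ _ (𝓖 k 0) inferInstance)
      (fun ω => (ω, s k h ω)) :=
    @Measurable.prodMk _ (𝓖 k h) _ _ (𝓖 k 0) _ _ _
      (measurable_id'' (run.mono_within hk (Nat.zero_le _) hh.le)) h1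
  exact @Measurable.prodMk _ (𝓖 k h) _ _ _ _ _ _ h1
    (@Measurable.comp _ _ _ (𝓖 k h) (@Prod.instMeasurableSpace _ _ (𝓖 k 0) inferInstance) _ _ _
      (run.measurable_policy k hk h hh) h2)

theorem lintegral_next {k h : ℕ} (hk : k < K) (hh : h < M.H) {g : Ω × S → ENNReal}
    (hg : Measurable[(𝓖 k h).prod inferInstance] g) :
    ∫⁻ ω, g (ω, s k (h + 1) ω) ∂Pr
      = ∫⁻ ω, ∫⁻ y, g (ω, y) ∂M.P h (visit greedy s f k h ω) ∂Pr :=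
  lintegral_of_transition (run.le k h)
    ((run.measurable_state k hk (h + 1) hh).mono (run.le k (h + 1)) le_rfl) (M.P h)
    (run.measurable_visit hk hh) (run.transition k hk h hh) hg

/-- Given the past of the episode, the state at step `h` has the law `stateLaw`. -/
theorem lintegral_state {k : ℕ} (hk : k < K) (h : ℕ) : h ≤ M.H → ∀ {g : Ω × S → ENNReal},
    Measurable[(𝓖 k 0).prod inferInstance] g →
    ∫⁻ ω, g (ω, s k h ω) ∂Pr
      = ∫⁻ ω, ∫⁻ y, g (ω, y) ∂stateLaw M (greedy (f k ω)) 0 M.s₁ h ∂Pr := by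
  induction h with
  | zero =>
    intro _ g hg
    refine lintegral_congr fun ω => ?_
    rw [run.init k hk ω]
    exact (lintegral_dirac' M.s₁
      (measurable_slice hg ω)).symm
  | succ h ih =>
    intro hh g hg
    have hle : (𝓖 k 0).prod (inferInstance : MeasurableSpace S) ≤ (𝓖 k h).prod inferInstance :=
      sup_le_sup (MeasurableSpace.comap_mono (run.mono_within hk (Nat.zero_le _) (by omega))) le_rfl
    have hpol := run.measurable_policy k hk h hh
    rw [run.lintegral_next hk hh (hg.mono hle le_rfl)]
    have h1 := ih (by omega) (g := fun p : Ω × S =>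
      ∫⁻ y, g (p.1, y) ∂M.P h (p.2, greedy (f k p.1) h p.2))
      (@measurable_lintegral_next Ω S A _ _ M (𝓖 k 0) (fun ω => greedy (f k ω)) h hpol g hg)
    refine h1.trans (lintegral_congr fun ω => ?_)
    exact (lintegral_stateLaw_succ
      (measurable_slice hpol ω) M.s₁
      (measurable_slice hg ω)).symm

end IsRun

end Run

/-! ### Excess loss and the exponential supermartingale. -/

section

variable {Ω S A : Type*} [MeasurableSpace S] [MeasurableSpace A] {M : MDP S A}
  {F G : ℕ → Set (S × A → ℝ)} {greedy : QTuple S A → ℕ → S → A}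

/-- The difference `g - T_h ζ_{h+1}`. -/
def gap (M : MDP S A) (g : S × A → ℝ) (ζ : QTuple S A) (h : ℕ) (x : S × A) : ℝ :=
  g x - bellman M h (ζ (h + 1)) x

/-- The excess of the squared loss of `g` over that of `T_h ζ_{h+1}` at one transition. -/
def excess (M : MDP S A) (g : S × A → ℝ) (ζ : QTuple S A) (h : ℕ) (x : S × A) (y : S) : ℝ :=
  (g x - M.r h x - ⨆ a, ζ (h + 1) (y, a)) ^ 2
    - (bellman M h (ζ (h + 1)) x - M.r h x - ⨆ a, ζ (h + 1) (y, a)) ^ 2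

/-- `T_h ζ_{h+1}` minus the reward is the conditional mean of the regression target, so the cross
term multiplies centred noise. -/
theorem excess_eq (g : S × A → ℝ) (ζ : QTuple S A) (h : ℕ) (x : S × A) (y : S) :
    excess M g ζ h x y = gap M g ζ h x ^ 2 - 2 * gap M g ζ h x *
      ((⨆ a, ζ (h + 1) (y, a)) - ∫ y, (⨆ a, ζ (h + 1) (y, a)) ∂M.P h x) := by
  unfold excess gap bellman
  ring

/-- Jensen's inequality points the wrong way here. Instead `exp (-u/4) ≤ 1 - u/5` on `[0, 1]` makes
the integrand linear in `u = φ²`, at the cost of replacing 4 by 5. -/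
theorem lintegral_exp_neg_sq_le {α : Type*} [MeasurableSpace α] {ν : Measure α}
    [IsProbabilityMeasure ν] {φ : α → ℝ} (hφ : Measurable φ) (h1 : ∀ x, |φ x| ≤ 1) :
    ∫⁻ x, ENNReal.ofReal (Real.exp (-(φ x ^ 2) / 4)) ∂ν
      ≤ ENNReal.ofReal (Real.exp (-(∫ x, φ x ^ 2 ∂ν) / 5)) := by
  have hsq : ∀ x, φ x ^ 2 ∈ Set.Icc (0 : ℝ) 1 := fun x => by
    refine ⟨sq_nonneg _, ?_⟩
    rw [← sq_abs]
    exact pow_le_one₀ (abs_nonneg _) (h1 x)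
  have hi : Integrable (fun x => φ x ^ 2) ν :=
    Integrable.of_mem_Icc 0 1 (hφ.pow_const 2).aemeasurable (ae_of_all _ hsq)
  have hpt : ∀ x, Real.exp (-(φ x ^ 2) / 4) ≤ 1 - φ x ^ 2 / 5 := fun x => by
    obtain ⟨h0, h2⟩ := hsq x
    set u := φ x ^ 2
    have h3 : 1 + u / 4 ≤ Real.exp (u / 4) := by linarith [Real.add_one_le_exp (u / 4)]
    have h4 : Real.exp (-u / 4) = (Real.exp (u / 4))⁻¹ := by
      rw [← Real.exp_neg]
      ring_nf
    rw [h4]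
    refine (inv_anti₀ (by positivity) h3).trans ?_
    rw [inv_le_iff_one_le_mul₀ (by positivity)]
    nlinarith
  calc ∫⁻ x, ENNReal.ofReal (Real.exp (-(φ x ^ 2) / 4)) ∂ν
      ≤ ∫⁻ x, ENNReal.ofReal (1 - φ x ^ 2 / 5) ∂ν :=
        lintegral_mono fun x => ENNReal.ofReal_le_ofReal (hpt x)
    _ = ENNReal.ofReal (∫ x, (1 - φ x ^ 2 / 5) ∂ν) :=
        (ofReal_integral_eq_lintegral_ofReal ((integrable_const _).sub (hi.div_const 5))
          (ae_of_all _ fun x => by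
            have := (hsq x).2
            simp only [Pi.zero_apply, Pi.sub_apply]
            linarith)).symm
    _ = ENNReal.ofReal (1 - (∫ x, φ x ^ 2 ∂ν) / 5) := by
        rw [integral_sub (integrable_const _) (hi.div_const 5), integral_div]
        simp
    _ ≤ _ := ENNReal.ofReal_le_ofReal (by
        have := Real.add_one_le_exp (-(∫ x, φ x ^ 2 ∂ν) / 5)
        linarith)

namespace Setting

variable (hs : Setting M F G greedy)
include hs

/-- Hoeffding's lemma: the noise comes from a `[0, 1]`-valued variable, so its variance proxy is
`1/4`, and at `2Δ` the exponent is `-Δ² + (2Δ)²/8 = -Δ²/2`. -/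
theorem lintegral_exp_neg_excess_le (g : S × A → ℝ) {ζ : QTuple S A} (hζ : ζ ∈ tuples M.H F)
    (h : ℕ) (x : S × A) :
    ∫⁻ y, ENNReal.ofReal (Real.exp (-excess M g ζ h x y)) ∂M.P h x
      ≤ ENNReal.ofReal (Real.exp (-(gap M g ζ h x ^ 2) / 2)) := by
  have hsub := hasSubgaussianMGF_of_mem_Icc (μ := M.P h x)
    (hs.measurable_iSup hζ (h + 1)).aemeasurable (ae_of_all _ (hs.iSup_mem_Icc hζ (h + 1)))
  set Δ := gap M g ζ h x
  have hm := hsub.mgf_le (2 * Δ)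
  have hint := hsub.integrable_exp_mul (2 * Δ)
  have heq : ∀ y, Real.exp (-excess M g ζ h x y) = Real.exp (-Δ ^ 2) * Real.exp (2 * Δ *
      ((⨆ a, ζ (h + 1) (y, a)) - ∫ y, (⨆ a, ζ (h + 1) (y, a)) ∂M.P h x)) := fun y => by
    rw [excess_eq, ← Real.exp_add]
    congr 1
    simp only [Δ]
    ring
  simp_rw [heq]
  rw [← ofReal_integral_eq_lintegral_ofReal (hint.const_mul _)
    (ae_of_all _ fun y => by positivity), integral_const_mul]
  refine ENNReal.ofReal_le_ofReal ?_
  refine (mul_le_mul_of_nonneg_left hm (Real.exp_pos _).le).trans ?_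
  rw [← Real.exp_add]
  refine Real.exp_le_exp.mpr (le_of_eq ?_)
  norm_num
  ring

theorem measurable_gap {g : S × A → ℝ} (hg : Measurable g) {ζ : QTuple S A}
    (hζ : ζ ∈ tuples M.H F) {h : ℕ} (hh : h < M.H) : Measurable (gap M g ζ h) :=
  hg.sub (hs.measurable_bellman hζ hh)

theorem abs_gap_le {g : S × A → ℝ} (hg : ∀ x, g x ∈ Set.Icc (0 : ℝ) 1) {ζ : QTuple S A}
    (hζ : ζ ∈ tuples M.H F) {h : ℕ} (hh : h < M.H) (x : S × A) : |gap M g ζ h x| ≤ 1 := by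
  have h1 := hg x
  have h2 := hs.bellman_mem_Icc hζ hh x
  unfold gap
  exact abs_le.mpr ⟨by linarith [h1.1, h2.2], by linarith [h1.2, h2.1]⟩

theorem measurable_excess {g : S × A → ℝ} (hg : Measurable g) {ζ : QTuple S A}
    (hζ : ζ ∈ tuples M.H F) {h : ℕ} (hh : h < M.H) :
    Measurable fun p : (S × A) × S => excess M g ζ h p.1 p.2 := by
  unfold excess
  have hfst : Measurable (Prod.fst : (S × A) × S → S × A) := measurable_fst
  have hsnd : Measurable (Prod.snd : (S × A) × S → S) := measurable_snd
  have h1 := (hs.measurable_bellman hζ hh).comp hfst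
  have h2 := (hs.measurable_iSup hζ (h + 1)).comp hsnd
  have h3 := (M.measurable_r h).comp hfst
  have h4 := hg.comp hfst
  exact (((h4.sub h3).sub h2).pow_const 2).sub (((h1.sub h3).sub h2).pow_const 2)

end Setting

section Supermartingale

variable [mΩ : MeasurableSpace Ω] {Pr : Measure Ω} [IsProbabilityMeasure Pr] {K : ℕ} {β : ℝ}
  {𝓖 : ℕ → ℕ → MeasurableSpace Ω} {s : ℕ → ℕ → Ω → S} {f : ℕ → Ω → QTuple S A}

/-- The expected squared gap along the greedy policy of `q`. -/
def meanSqGap (M : MDP S A) (greedy : QTuple S A → ℕ → S → A) (g : S × A → ℝ) (ζ : QTuple S A)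
    (h : ℕ) (q : QTuple S A) : ℝ :=
  ∫ y, gap M g ζ h (y, greedy q h y) ^ 2 ∂stateLaw M (greedy q) 0 M.s₁ h

/-- The logarithm of the supermartingale increment of episode `t`. -/
def logWeight (M : MDP S A) (greedy : QTuple S A → ℕ → S → A) (s : ℕ → ℕ → Ω → S)
    (f : ℕ → Ω → QTuple S A) (g : S × A → ℝ) (ζ : QTuple S A) (h t : ℕ) (ω : Ω) : ℝ :=
  -excess M g ζ h (visit greedy s f t h ω) (s t (h + 1) ω)
    + gap M g ζ h (visit greedy s f t h ω) ^ 2 / 4 + meanSqGap M greedy g ζ h (f t ω) / 5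

namespace IsRun

variable (run : IsRun Pr M F G greedy K β 𝓖 s f) (hs : Setting M F G greedy)
include run hs

omit [IsProbabilityMeasure Pr] in
theorem measurable_meanSqGap {g : S × A → ℝ} (hg : Measurable g) {ζ : QTuple S A}
    (hζ : ζ ∈ tuples M.H F) {h : ℕ} (hh : h < M.H) {t : ℕ} (ht : t < K) :
    Measurable[𝓖 t 0] fun ω => meanSqGap M greedy g ζ h (f t ω) := by
  have hm := hs.measurable_gap hg hζ hh
  have hpol := run.measurable_policy t ht
  have h2 : @Measurable _ _ ((𝓖 t 0).prod inferInstance) _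
      (fun p : Ω × S => gap M g ζ h (p.2, greedy (f t p.1) h p.2) ^ 2) :=
    ((hm.comp (Measurable.prodMk measurable_snd (hpol h hh))).pow_const 2)
  exact @measurable_integral_stateLaw Ω S A _ _ M (𝓖 t 0) (fun ω => greedy (f t ω)) hpol M.s₁ h
    hh.le _ h2 fun _ => sq_nonneg _

omit [IsProbabilityMeasure Pr] in
theorem measurable_logWeight {g : S × A → ℝ} (hg : Measurable g) {ζ : QTuple S A}
    (hζ : ζ ∈ tuples M.H F) {h : ℕ} (hh : h < M.H) {t : ℕ} (ht : t < K) :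
    Measurable[𝓖 t (h + 1)] (logWeight M greedy s f g ζ h t) := by
  have h1 : Measurable[𝓖 t (h + 1)] (visit greedy s f t h) :=
    (run.measurable_visit ht hh).mono (run.mono_step t ht h hh) le_rfl
  have h2 := run.measurable_state t ht (h + 1) hh
  have h3 : Measurable[𝓖 t (h + 1)] fun ω => meanSqGap M greedy g ζ h (f t ω) :=
    (run.measurable_meanSqGap hs hg hζ hh ht).mono
      (run.mono_within ht (Nat.zero_le _) hh) le_rfl
  have h4 : Measurable[𝓖 t (h + 1)] fun ω =>
      excess M g ζ h (visit greedy s f t h ω) (s t (h + 1) ω) :=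
    (hs.measurable_excess hg hζ hh).comp (h1.prodMk h2)
  have h5 : Measurable[𝓖 t (h + 1)] fun ω => gap M g ζ h (visit greedy s f t h ω) :=
    (hs.measurable_gap hg hζ hh).comp h1
  exact (h4.neg.add ((h5.pow_const 2).div_const 4)).add (h3.div_const 5)

omit [IsProbabilityMeasure Pr] in
theorem measurable_sum_logWeight {g : S × A → ℝ} (hg : Measurable g) {ζ : QTuple S A}
    (hζ : ζ ∈ tuples M.H F) {h : ℕ} (hh : h < M.H) {k : ℕ} (hk : k ≤ K) :
    Measurable[𝓖 k 0] fun ω => ∑ t ∈ Finset.range k, logWeight M greedy s f g ζ h t ω := by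
  refine Finset.measurable_fun_sum _ fun t ht => ?_
  have ht := Finset.mem_range.mp ht
  exact (run.measurable_logWeight hs hg hζ hh (by omega)).mono (run.le_start ht hk hh) le_rfl

/-- Integrating out the next state yields a factor `exp (-gap²/2)`. Half of it cancels the observed
term `gap²/4`; the other half, averaged over the state at step `h` under the policy fixed before the
episode, cancels `meanSqGap / 5`. -/
theorem lintegral_exp_sum_logWeight_le {g : S × A → ℝ} (hg : Measurable g)
    (hg1 : ∀ x, g x ∈ Set.Icc (0 : ℝ) 1) {ζ : QTuple S A}
    (hζ : ζ ∈ tuples M.H F) {h : ℕ} (hh : h < M.H) (k : ℕ) : k ≤ K →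
    ∫⁻ ω, ENNReal.ofReal (Real.exp (∑ t ∈ Finset.range k, logWeight M greedy s f g ζ h t ω)) ∂Pr
      ≤ 1 := by
  induction k with
  | zero => intro _; simp
  | succ k ih =>
    intro hk
    have hk' : k < K := hk
    refine le_trans ?_ (ih hk'.le)
    have hmz := run.measurable_sum_logWeight hs hg hζ hh hk'.le
    have hmE := run.measurable_meanSqGap hs hg hζ hh hk'
    have hmv := run.measurable_visit hk' hh
    have hmgap := hs.measurable_gap hg hζ hh
    have hmexc := hs.measurable_excess hg hζ hh
    have hle : 𝓖 k 0 ≤ 𝓖 k h := run.mono_within hk' (Nat.zero_le _) hh.le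
    set z : Ω → ℝ := fun ω => ∑ t ∈ Finset.range k, logWeight M greedy s f g ζ h t ω with hz
    set E : Ω → ℝ := fun ω => meanSqGap M greedy g ζ h (f k ω) with hE
    set v : Ω → S × A := visit greedy s f k h with hv
    have hmg1 : Measurable[(𝓖 k h).prod inferInstance] fun p : Ω × S => ENNReal.ofReal
        (Real.exp (z p.1 + E p.1 / 5 + gap M g ζ h (v p.1) ^ 2 / 4)) *
          ENNReal.ofReal (Real.exp (-excess M g ζ h (v p.1) p.2)) := by
      have hmz' := hmz.mono hle le_rfl
      have hmE' := hmE.mono hle le_rfl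
      have a1 : Measurable[𝓖 k h] fun ω => z ω + E ω / 5 + gap M g ζ h (v ω) ^ 2 / 4 :=
        (hmz'.add (hmE'.div_const 5)).add (((hmgap.comp hmv).pow_const 2).div_const 4)
      have a2 : @Measurable _ _ ((𝓖 k h).prod inferInstance) _ fun p : Ω × S =>
          excess M g ζ h (v p.1) p.2 :=
        hmexc.comp ((hmv.comp measurable_fst).prodMk measurable_snd)
      exact ((a1.comp measurable_fst).exp.ennreal_ofReal).mul a2.neg.exp.ennreal_ofReal
    have hmg2 : Measurable[(𝓖 k 0).prod inferInstance] fun p : Ω × S => ENNReal.ofReal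
        (Real.exp (z p.1 + E p.1 / 5)) * ENNReal.ofReal
          (Real.exp (-(gap M g ζ h (p.2, greedy (f k p.1) h p.2) ^ 2) / 4)) := by
      have a1 : Measurable[𝓖 k 0] fun ω => z ω + E ω / 5 := hmz.add (hmE.div_const 5)
      have a2 : @Measurable _ _ ((𝓖 k 0).prod inferInstance) _ fun p : Ω × S =>
          gap M g ζ h (p.2, greedy (f k p.1) h p.2) :=
        hmgap.comp (Measurable.prodMk measurable_snd (run.measurable_policy k hk' h hh))
      exact ((a1.comp measurable_fst).exp.ennreal_ofReal).mul
        (((a2.pow_const 2).neg.div_const 4).exp.ennreal_ofReal)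
    calc ∫⁻ ω, ENNReal.ofReal
          (Real.exp (∑ t ∈ Finset.range (k + 1), logWeight M greedy s f g ζ h t ω)) ∂Pr
        = ∫⁻ ω, ENNReal.ofReal (Real.exp (z ω + E ω / 5 + gap M g ζ h (v ω) ^ 2 / 4)) *
            ENNReal.ofReal (Real.exp (-excess M g ζ h (v ω) (s k (h + 1) ω))) ∂Pr := by
          refine lintegral_congr fun ω => ?_
          rw [← ENNReal.ofReal_mul (Real.exp_pos _).le, ← Real.exp_add, Finset.sum_range_succ]
          congr 2
          simp only [hz, hE, hv, logWeight]
          ring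
      _ = ∫⁻ ω, ∫⁻ y, ENNReal.ofReal (Real.exp (z ω + E ω / 5 + gap M g ζ h (v ω) ^ 2 / 4)) *
            ENNReal.ofReal (Real.exp (-excess M g ζ h (v ω) y)) ∂M.P h (v ω) ∂Pr :=
          run.lintegral_next hk' hh hmg1
      _ ≤ ∫⁻ ω, ENNReal.ofReal (Real.exp (z ω + E ω / 5)) * ENNReal.ofReal
            (Real.exp (-(gap M g ζ h (s k h ω, greedy (f k ω) h (s k h ω)) ^ 2) / 4)) ∂Pr := by
          refine lintegral_mono fun ω => ?_
          rw [lintegral_const_mul' _ _ ENNReal.ofReal_ne_top]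
          refine (mul_le_mul_right (hs.lintegral_exp_neg_excess_le g hζ h (v ω)) _).trans ?_
          rw [← ENNReal.ofReal_mul (Real.exp_pos _).le, ← Real.exp_add,
            ← ENNReal.ofReal_mul (Real.exp_pos _).le, ← Real.exp_add]
          refine ENNReal.ofReal_le_ofReal (Real.exp_le_exp.mpr (le_of_eq ?_))
          have : v ω = (s k h ω, greedy (f k ω) h (s k h ω)) := rfl
          rw [this]
          ring
      _ = ∫⁻ ω, ∫⁻ y, ENNReal.ofReal (Real.exp (z ω + E ω / 5)) * ENNReal.ofReal
            (Real.exp (-(gap M g ζ h (y, greedy (f k ω) h y) ^ 2) / 4))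
              ∂stateLaw M (greedy (f k ω)) 0 M.s₁ h ∂Pr := run.lintegral_state hk' h hh.le hmg2
      _ ≤ ∫⁻ ω, ENNReal.ofReal (Real.exp (z ω)) ∂Pr := by
          refine lintegral_mono fun ω => ?_
          have hπ := hs.measurable_greedy (run.mem k hk' ω)
          have := isProbabilityMeasure_stateLaw (M := M) hπ 0 M.s₁ h
          rw [lintegral_const_mul' _ _ ENNReal.ofReal_ne_top]
          refine (mul_le_mul_right (lintegral_exp_neg_sq_le
            (φ := fun y => gap M g ζ h (y, greedy (f k ω) h y))
            (hmgap.comp (measurable_id.prodMk (hπ h)))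
            fun y => hs.abs_gap_le hg1 hζ hh _) _).trans ?_
          rw [← ENNReal.ofReal_mul (Real.exp_pos _).le, ← Real.exp_add]
          refine ENNReal.ofReal_le_ofReal (Real.exp_le_exp.mpr (le_of_eq ?_))
          simp only [hE, meanSqGap]
          ring

/-- The exponential tail bound for a fixed function `g` and a fixed target `ζ`. -/
theorem measure_logWeight_ge_le {g : S × A → ℝ} (hg : Measurable g)
    (hg1 : ∀ x, g x ∈ Set.Icc (0 : ℝ) 1) {ζ : QTuple S A}
    (hζ : ζ ∈ tuples M.H F) {h : ℕ} (hh : h < M.H) {k : ℕ} (hk : k ≤ K) (τ : ℝ) :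
    Pr {ω | τ ≤ ∑ t ∈ Finset.range k, logWeight M greedy s f g ζ h t ω}
      ≤ ENNReal.ofReal (Real.exp (-τ)) := by
  have hm : Measurable fun ω => ∑ t ∈ Finset.range k, logWeight M greedy s f g ζ h t ω :=
    (run.measurable_sum_logWeight hs hg hζ hh hk).mono (run.le k 0) le_rfl
  have h1 := mul_meas_ge_le_lintegral₀ (μ := Pr) hm.exp.ennreal_ofReal.aemeasurable
    (ENNReal.ofReal (Real.exp τ))
  have h2 := h1.trans (run.lintegral_exp_sum_logWeight_le hs hg hg1 hζ hh k hk)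
  have h3 : {ω | τ ≤ ∑ t ∈ Finset.range k, logWeight M greedy s f g ζ h t ω}
      ⊆ {ω | ENNReal.ofReal (Real.exp τ) ≤ ENNReal.ofReal
          (Real.exp (∑ t ∈ Finset.range k, logWeight M greedy s f g ζ h t ω))} := fun ω hω =>
    ENNReal.ofReal_le_ofReal (Real.exp_le_exp.mpr hω)
  refine (measure_mono h3).trans ?_
  rw [Real.exp_neg, ENNReal.ofReal_inv_of_pos (Real.exp_pos _)]
  refine (ENNReal.le_inv_iff_mul_le).mpr ?_
  rwa [mul_comm]

end IsRun

end Supermartingale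

end

/-! ### Covers, perturbation bounds and the concentration event. -/

section

variable {Ω S A : Type*}

section Covers

/-- A class inside a set with a finite `ρ`-covering number has a `2ρ`-cover of the same size by
its own elements. -/
theorem exists_inner_cover {V X : Set (QTuple S A)} {ρ : ℝ} {N : ℕ}
    (hN : (N : ℕ∞) = coverNum V ρ) (hX : X ⊆ V) :
    ∃ D : Finset (QTuple S A), D.card ≤ N ∧ (∀ g ∈ D, g ∈ X) ∧
      ∀ f ∈ X, ∃ g ∈ D, ∀ h x, |f h x - g h x| ≤ 2 * ρ := by
  classical
  have hlt : coverNum V ρ < ((N + 1 : ℕ) : ℕ∞) := by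
    rw [← hN]
    exact_mod_cast Nat.lt_succ_self N
  unfold coverNum at hlt
  simp only [iInf_lt_iff] at hlt
  obtain ⟨C, ⟨_, hcov⟩, hC⟩ := hlt
  have hfin : C.Finite := Set.finite_of_encard_le_coe hC.le
  have hcard : hfin.toFinset.card ≤ N := by
    rw [hfin.encard_eq_coe_toFinset_card] at hC
    exact Nat.lt_succ_iff.mp (by exact_mod_cast hC)
  let close : QTuple S A → QTuple S A → Prop := fun f g => ∀ h x, |f h x - g h x| ≤ ρ
  -- A centre may lie outside `X`, where the estimates need not apply, so it is replaced by a nearby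
  -- element of `X`, doubling the radius. The default `0` never enters the filtered set.
  let pick : QTuple S A → QTuple S A := fun c =>
    if hc : ∃ f ∈ X, close f c then hc.choose else 0
  have hpick : ∀ c, (∃ f ∈ X, close f c) → pick c ∈ X ∧ close (pick c) c := fun c hc => by
    simp only [pick, dif_pos hc]
    exact hc.choose_spec
  refine ⟨(hfin.toFinset.filter fun c => ∃ f ∈ X, close f c).image pick,
    (Finset.card_image_le.trans (Finset.card_filter_le _ _)).trans hcard, ?_, ?_⟩
  · intro g hg
    obtain ⟨c, hc, rfl⟩ := Finset.mem_image.mp hg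
    exact (hpick c (Finset.mem_filter.mp hc).2).1
  · intro f hf
    obtain ⟨c, hcC, hfc⟩ := hcov f (hX hf)
    have hc : ∃ f ∈ X, close f c := ⟨f, hf, hfc⟩
    refine ⟨pick c, Finset.mem_image_of_mem _
      (Finset.mem_filter.mpr ⟨hfin.mem_toFinset.mpr hcC, hc⟩), fun h x => ?_⟩
    have h1 := abs_le.mp (hfc h x)
    have h2 := abs_le.mp ((hpick c hc).2 h x)
    exact abs_le.mpr ⟨by linarith [h1.1, h2.2], by linarith [h1.2, h2.1]⟩

end Covers

theorem abs_mul_sub_mul_le {a a' b b' η : ℝ} (ha' : |a'| ≤ 1) (hb : |b| ≤ 1)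
    (h1 : |a - a'| ≤ η) (h2 : |b - b'| ≤ η) : |a * b - a' * b'| ≤ 2 * η := by
  have h3 : a * b - a' * b' = (a - a') * b + a' * (b - b') := by ring
  have h0 : 0 ≤ η := (abs_nonneg _).trans h1
  calc |a * b - a' * b'| ≤ |a - a'| * |b| + |a'| * |b - b'| := by
        rw [h3, ← abs_mul, ← abs_mul]
        exact abs_add_le _ _
    _ ≤ η * 1 + 1 * η := by gcongr
    _ = 2 * η := by ring

variable [MeasurableSpace S] [MeasurableSpace A] {M : MDP S A}
  {F G : ℕ → Set (S × A → ℝ)} {greedy : QTuple S A → ℕ → S → A}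

namespace Setting

variable (hs : Setting M F G greedy)
include hs

theorem G_nonempty {h : ℕ} (hh : h < M.H) : (G h).Nonempty :=
  ⟨_, hs.bellman_mem hs.qStarTuple_mem hh⟩

/-- The cover consists of tuples, while the infimum in the confidence set runs over one component;
the backups of `Q*` fill the others. -/
theorem exists_tuple_G {h : ℕ} (hh : h < M.H) {g : S × A → ℝ} (hg : g ∈ G h) :
    ∃ q ∈ tuples M.H G, q h = g := by
  classical
  let q₀ : QTuple S A := fun h => if h < M.H then bellman M h (qStarTuple M (h + 1)) else 0
  refine ⟨Function.update q₀ h g, fun h' => ?_, by simp⟩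
  unfold withTerminal
  rcases eq_or_ne h' h with rfl | hne
  · simpa [hh] using hg
  · rw [Function.update_of_ne hne]
    simp only [q₀]
    split_ifs with hh'
    · exact hs.bellman_mem hs.qStarTuple_mem hh'
    · rfl

section Perturbation

variable {g g' : S × A → ℝ} (hg : ∀ x, g x ∈ Set.Icc (0 : ℝ) 1)
  (hg' : ∀ x, g' x ∈ Set.Icc (0 : ℝ) 1) {ζ ζ' : QTuple S A} (hζ : ζ ∈ tuples M.H F)
  (hζ' : ζ' ∈ tuples M.H F) {h : ℕ} (hh : h < M.H) {η : ℝ} (hη : ∀ x, |g x - g' x| ≤ η)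
  (hηζ : ∀ x, |ζ (h + 1) x - ζ' (h + 1) x| ≤ η)
include hg hg' hζ hζ' hh hη hηζ

omit hg hg' hh in
theorem abs_gap_sub_le (x : S × A) : |gap M g ζ h x - gap M g' ζ' h x| ≤ 2 * η := by
  have h1 := abs_le.mp (hη x)
  have h2 := abs_le.mp (hs.abs_bellman_sub_le hζ hζ' hηζ x)
  unfold gap
  exact abs_le.mpr ⟨by linarith [h1.1, h2.2], by linarith [h1.2, h2.1]⟩

theorem abs_gap_sq_sub_le (x : S × A) :
    |gap M g ζ h x ^ 2 - gap M g' ζ' h x ^ 2| ≤ 4 * η := by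
  have h1 := hs.abs_gap_sub_le hζ hζ' hη hηζ x
  have := abs_mul_sub_mul_le (hs.abs_gap_le hg' hζ' hh x) (hs.abs_gap_le hg hζ hh x) h1 h1
  rw [pow_two, pow_two]
  linarith

theorem abs_excess_sub_le (x : S × A) (y : S) :
    |excess M g ζ h x y - excess M g' ζ' h x y| ≤ 12 * η := by
  rw [excess_eq, excess_eq]
  have h1 := hs.abs_gap_sub_le hζ hζ' hη hηζ x
  have h2 := abs_le.mp (hs.abs_gap_sq_sub_le hg hg' hζ hζ' hh hη hηζ x)
  have h3 := abs_le.mp (hs.abs_iSup_sub_le hζ hζ' hηζ y)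
  have h4 := abs_le.mp (abs_integral_sub_le (hs.integrable_iSup hζ (h + 1) (M.P h x))
    (hs.integrable_iSup hζ' (h + 1) (M.P h x)) (hs.abs_iSup_sub_le hζ hζ' hηζ))
  have h5 := hs.iSup_mem_Icc hζ (h + 1) y
  have h6 : ∫ y, (⨆ a, ζ (h + 1) (y, a)) ∂M.P h x ∈ Set.Icc (0 : ℝ) 1 :=
    integral_mem_Icc (hs.measurable_iSup hζ (h + 1)).aemeasurable (hs.iSup_mem_Icc hζ (h + 1))
  set u := ⨆ a, ζ (h + 1) (y, a)
  set u' := ⨆ a, ζ' (h + 1) (y, a)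
  set v := ∫ y, (⨆ a, ζ (h + 1) (y, a)) ∂M.P h x
  set v' := ∫ y, (⨆ a, ζ' (h + 1) (y, a)) ∂M.P h x
  have h7 : |(u - v) - (u' - v')| ≤ 2 * η :=
    abs_le.mpr ⟨by linarith [h3.1, h4.2], by linarith [h3.2, h4.1]⟩
  have h8 : |u - v| ≤ 1 := abs_le.mpr ⟨by linarith [h5.1, h6.2], by linarith [h5.2, h6.1]⟩
  have h9 := abs_le.mp (abs_mul_sub_mul_le (hs.abs_gap_le hg' hζ' hh x) h8 h1 h7)
  exact abs_le.mpr ⟨by linarith [h9.2, h2.1], by linarith [h9.1, h2.2]⟩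

theorem abs_meanSqGap_sub_le (hgm : Measurable g) (hgm' : Measurable g') {q : QTuple S A}
    (hq : q ∈ tuples M.H F) :
    |meanSqGap M greedy g ζ h q - meanSqGap M greedy g' ζ' h q| ≤ 4 * η := by
  have hπ := hs.measurable_greedy hq
  have := isProbabilityMeasure_stateLaw (M := M) hπ 0 M.s₁ h
  have hint : ∀ {g : S × A → ℝ} {ζ : QTuple S A}, Measurable g → (∀ x, g x ∈ Set.Icc (0 : ℝ) 1) →
      ζ ∈ tuples M.H F → Integrable (fun y => gap M g ζ h (y, greedy q h y) ^ 2)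
        (stateLaw M (greedy q) 0 M.s₁ h) := fun hgm hg hζ =>
    Integrable.of_mem_Icc 0 1 (((hs.measurable_gap hgm hζ hh).comp
      (measurable_id.prodMk (hπ h))).pow_const 2).aemeasurable (ae_of_all _ fun y =>
        ⟨sq_nonneg _, by
          rw [← sq_abs]
          exact pow_le_one₀ (abs_nonneg _) (hs.abs_gap_le hg hζ hh _)⟩)
  exact abs_integral_sub_le (hint hgm hg hζ) (hint hgm' hg' hζ') fun y =>
    hs.abs_gap_sq_sub_le hg hg' hζ hζ' hh hη hηζ _

/-- The excess contributes `12η` and the squared gaps `4η/4` and `4η/5`, rounded up to `14η`. -/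
theorem logWeight_le_add (hgm : Measurable g) (hgm' : Measurable g') {s : ℕ → ℕ → Ω → S}
    {f : ℕ → Ω → QTuple S A} {t : ℕ} {ω : Ω} (hq : f t ω ∈ tuples M.H F) :
    logWeight M greedy s f g ζ h t ω ≤ logWeight M greedy s f g' ζ' h t ω + 14 * η := by
  have h0 : 0 ≤ η := (abs_nonneg _).trans (hη (M.s₁, greedy 0 0 M.s₁))
  have h1 := abs_le.mp (hs.abs_gap_sq_sub_le hg hg' hζ hζ' hh hη hηζ (visit greedy s f t h ω))
  have h2 := abs_le.mp (hs.abs_excess_sub_le hg hg' hζ hζ' hh hη hηζ (visit greedy s f t h ω)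
    (s t (h + 1) ω))
  have h3 := abs_le.mp (hs.abs_meanSqGap_sub_le hg hg' hζ hζ' hh hη hηζ hgm hgm' hq)
  unfold logWeight
  linarith [h1.2, h2.1, h3.2]

end Perturbation

end Setting

theorem meanSqGap_nonneg (g : S × A → ℝ) (ζ : QTuple S A) (h : ℕ) (q : QTuple S A) :
    0 ≤ meanSqGap M greedy g ζ h q := integral_nonneg fun _ => sq_nonneg _

theorem loss_sub_loss_bellman (s : ℕ → ℕ → Ω → S) (f : ℕ → Ω → QTuple S A) (ω : Ω) (k h : ℕ)
    (g : S × A → ℝ) (ζ : QTuple S A) :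
    loss M (fun i h => s i h ω) (action greedy s f ω) k h g (ζ (h + 1))
        - loss M (fun i h => s i h ω) (action greedy s f ω) k h
            (bellman M h (ζ (h + 1))) (ζ (h + 1))
      = ∑ t ∈ Finset.range k, excess M g ζ h (visit greedy s f t h ω) (s t (h + 1) ω) := by
  unfold loss
  rw [← Finset.sum_sub_distrib]
  rfl

section Good

variable [MeasurableSpace Ω] {Pr : Measure Ω} [IsProbabilityMeasure Pr] {K : ℕ} {β : ℝ}
  {𝓖 : ℕ → ℕ → MeasurableSpace Ω} {s : ℕ → ℕ → Ω → S} {f : ℕ → Ω → QTuple S A}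

/-- The event that all the supermartingales stay below the level `b`. -/
def Concentrated (M : MDP S A) (F G : ℕ → Set (S × A → ℝ)) (greedy : QTuple S A → ℕ → S → A)
    (K : ℕ) (s : ℕ → ℕ → Ω → S) (f : ℕ → Ω → QTuple S A) (b : ℝ) (ω : Ω) : Prop :=
  ∀ k < K, ∀ h < M.H,
    (∀ q ∈ tuples M.H F, ∑ t ∈ Finset.range k, logWeight M greedy s f (q h) q h t ω ≤ b) ∧
    ∀ g ∈ G h, ∑ t ∈ Finset.range k, logWeight M greedy s f g (qStarTuple M) h t ω ≤ b

/-- Union bound over episodes, steps and two covers of at most `N` elements each. Radius `2ρ` costs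
`14 * 2ρ` per episode, hence the term `28 K ρ`. -/
theorem IsRun.exists_bad_event (run : IsRun Pr M F G greedy K β 𝓖 s f)
    (hs : Setting M F G greedy) {ρ : ℝ} (hρ : 0 ≤ ρ) {N : ℕ}
    (hN : (N : ℕ∞) = coverNum (tuples M.H F ∪ tuples M.H G) ρ) (τ : ℝ) :
    ∃ B : Set Ω, MeasurableSet B ∧
      Pr B ≤ (2 * N * M.H * K : ℕ) * ENNReal.ofReal (Real.exp (-τ)) ∧
      ∀ ω ∉ B, Concentrated M F G greedy K s f (τ + 28 * K * ρ) ω := by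
  obtain ⟨DF, hDFc, hDF, hcovF⟩ := exists_inner_cover hN Set.subset_union_left
  obtain ⟨DG, hDGc, hDG, hcovG⟩ := exists_inner_cover hN Set.subset_union_right
  set BF : ℕ × ℕ × QTuple S A → Set Ω := fun p => {ω | τ ≤ ∑ t ∈ Finset.range p.1,
    logWeight M greedy s f (p.2.2 p.2.1) p.2.2 p.2.1 t ω} with hBF
  set BG : ℕ × ℕ × QTuple S A → Set Ω := fun p => {ω | τ ≤ ∑ t ∈ Finset.range p.1,
    logWeight M greedy s f (p.2.2 p.2.1) (qStarTuple M) p.2.1 t ω} with hBG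
  set IF := Finset.range K ×ˢ Finset.range M.H ×ˢ DF with hIF
  set IG := Finset.range K ×ˢ Finset.range M.H ×ˢ DG with hIG
  set U : Set Ω := (⋃ p ∈ IF, BF p) ∪ ⋃ p ∈ IG, BG p with hU
  have hclassG : ∀ {h}, h < M.H → ∀ q ∈ tuples M.H G,
      Measurable (q h) ∧ ∀ x, q h x ∈ Set.Icc (0 : ℝ) 1 := fun {h} hh q hq => by
    have := hq h
    unfold withTerminal at this
    rw [if_pos hh] at this
    exact hs.classG h hh _ this
  -- The measurable hull has the same measure, and spares the verification that `U` is measurable.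
  refine ⟨toMeasurable Pr U, measurableSet_toMeasurable _ _, ?_, ?_⟩
  · rw [measure_toMeasurable]
    have h1 : Pr (⋃ p ∈ IF, BF p) ≤ (K * (M.H * N) : ℕ) * ENNReal.ofReal (Real.exp (-τ)) := by
      refine (measure_biUnion_finset_le _ _).trans ?_
      refine (Finset.sum_le_card_nsmul _ _ (ENNReal.ofReal (Real.exp (-τ))) ?_).trans ?_
      · rintro ⟨k, h, q⟩ hp
        simp only [hIF, Finset.mem_product, Finset.mem_range] at hp
        have hq := hs.measurable_and_mem_Icc (hDF q hp.2.2) h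
        exact run.measure_logWeight_ge_le hs hq.1 hq.2 (hDF q hp.2.2) hp.2.1 hp.1.le τ
      · rw [nsmul_eq_mul]
        gcongr
        simp only [hIF, Finset.card_product, Finset.card_range]
        gcongr
    have h2 : Pr (⋃ p ∈ IG, BG p) ≤ (K * (M.H * N) : ℕ) * ENNReal.ofReal (Real.exp (-τ)) := by
      refine (measure_biUnion_finset_le _ _).trans ?_
      refine (Finset.sum_le_card_nsmul _ _ (ENNReal.ofReal (Real.exp (-τ))) ?_).trans ?_
      · rintro ⟨k, h, q⟩ hp
        simp only [hIG, Finset.mem_product, Finset.mem_range] at hp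
        have hq := hclassG hp.2.1 q (hDG q hp.2.2)
        exact run.measure_logWeight_ge_le hs hq.1 hq.2 hs.qStarTuple_mem hp.2.1 hp.1.le τ
      · rw [nsmul_eq_mul]
        gcongr
        simp only [hIG, Finset.card_product, Finset.card_range]
        gcongr
    refine (measure_union_le _ _).trans ((add_le_add h1 h2).trans (le_of_eq ?_))
    rw [← add_mul, ← Nat.cast_add]
    congr 2
    ring
  · intro ω hω k hk h hh
    have hωU : ω ∉ U := fun hu => hω (subset_toMeasurable _ _ hu)
    have hkK : (k : ℝ) ≤ K := by exact_mod_cast hk.le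
    have hsum : ∀ {g g' : S × A → ℝ} {ζ ζ' : QTuple S A},
        (∀ t < k, logWeight M greedy s f g ζ h t ω
          ≤ logWeight M greedy s f g' ζ' h t ω + 14 * (2 * ρ)) →
        ∑ t ∈ Finset.range k, logWeight M greedy s f g' ζ' h t ω < τ →
        ∑ t ∈ Finset.range k, logWeight M greedy s f g ζ h t ω ≤ τ + 28 * K * ρ := by
      intro g g' ζ ζ' hle hlt
      have h1 := Finset.sum_le_sum fun t ht => hle t (Finset.mem_range.mp ht)
      rw [Finset.sum_add_distrib, Finset.sum_const, Finset.card_range, nsmul_eq_mul] at h1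
      have h2 : (k : ℝ) * ρ ≤ K * ρ := by gcongr
      linarith
    constructor
    · intro q hq
      obtain ⟨q', hq', hclose⟩ := hcovF q hq
      have hq'F := hDF q' hq'
      have a1 := hs.measurable_and_mem_Icc hq h
      have a2 := hs.measurable_and_mem_Icc hq'F h
      refine hsum (g' := q' h) (ζ' := q') (fun t ht => ?_) ?_
      · exact hs.logWeight_le_add a1.2 a2.2 hq hq'F hh (hclose h) (hclose (h + 1)) a1.1 a2.1
          (run.mem t (ht.trans hk) ω)
      · by_contra hcon
        refine hωU (Or.inl (Set.mem_iUnion₂.mpr ⟨(k, h, q'), ?_, not_lt.mp hcon⟩))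
        simp [hIF, hk, hh, hq']
    · intro g hg
      obtain ⟨q, hq, rfl⟩ := hs.exists_tuple_G hh hg
      obtain ⟨q', hq', hclose⟩ := hcovG q hq
      have a1 := hclassG hh q hq
      have a2 := hclassG hh q' (hDG q' hq')
      refine hsum (g' := q' h) (ζ' := qStarTuple M) (fun t ht => ?_) ?_
      · exact hs.logWeight_le_add a1.2 a2.2 hs.qStarTuple_mem hs.qStarTuple_mem hh (hclose h)
          (fun x => by simp [hρ]) a1.1 a2.1 (run.mem t (ht.trans hk) ω)
      · by_contra hcon
        refine hωU (Or.inr (Set.mem_iUnion₂.mpr ⟨(k, h, q'), ?_, not_lt.mp hcon⟩))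
        simp [hIG, hk, hh, hq']

omit [MeasurableSpace Ω] in
/-- On the concentration event, `Q*` stays in the confidence set. -/
theorem Setting.qStarTuple_mem_confSet (hs : Setting M F G greedy) {b : ℝ} (hb : b ≤ β) {ω : Ω}
    (hc : Concentrated M F G greedy K s f b ω) {k : ℕ} (hk : k < K) :
    qStarTuple M ∈ confSet M F G β (fun i h => s i h ω) (action greedy s f ω) k := by
  refine ⟨hs.qStarTuple_mem, fun h hh => ?_⟩
  have : Nonempty (G h) := (hs.G_nonempty hh).to_subtype
  rw [← sub_le_iff_le_add]
  refine le_ciInf fun g => ?_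
  have h1 := loss_sub_loss_bellman (M := M) (greedy := greedy) s f ω k h g (qStarTuple M)
  rw [hs.bellman_qStar hh] at h1
  have h2 := (hc k hk h hh).2 g g.2
  -- By the Bellman equation the reference loss is that of `Q*_h` itself, so dropping the
  -- nonnegative square terms bounds its loss over that of any `g`.
  have h3 : -∑ t ∈ Finset.range k,
      excess M g (qStarTuple M) h (visit greedy s f t h ω) (s t (h + 1) ω)
      ≤ ∑ t ∈ Finset.range k, logWeight M greedy s f g (qStarTuple M) h t ω := by
    rw [← Finset.sum_neg_distrib]
    refine Finset.sum_le_sum fun t _ => ?_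
    unfold logWeight
    have := meanSqGap_nonneg (M := M) (greedy := greedy) g (qStarTuple M) h (f t ω)
    have := sq_nonneg (gap M g (qStarTuple M) h (visit greedy s f t h ω))
    linarith
  linarith

omit [IsProbabilityMeasure Pr] in
/-- On the concentration event, the chosen functions have small Bellman residuals on the past
data, both empirically and in expectation. -/
theorem IsRun.sum_gap_le (run : IsRun Pr M F G greedy K β 𝓖 s f) (hs : Setting M F G greedy)
    {b : ℝ} (hb : b ≤ β) {ω : Ω}
    (hc : Concentrated M F G greedy K s f b ω) {k h : ℕ} (hk : k < K) (hh : h < M.H) :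
    ∑ t ∈ Finset.range k, residual M (f k ω) h (visit greedy s f t h ω) ^ 2 ≤ 5 * (β + b) ∧
    ∑ t ∈ Finset.range k, meanSqGap M greedy (f k ω h) (f k ω) h (f t ω) ≤ 5 * (β + b) := by
  have hmem := (run.optimistic k hk ω ⟨_, hs.qStarTuple_mem_confSet hb hc hk⟩).1
  have hF := run.mem k hk ω
  have h1 := hmem.2 h hh
  have h2 := loss_sub_loss_bellman (M := M) (greedy := greedy) s f ω k h (f k ω h) (f k ω)
  have h3 : (⨅ g : G h, loss M (fun i h => s i h ω) (action greedy s f ω) k h g (f k ω (h + 1)))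
      ≤ loss M (fun i h => s i h ω) (action greedy s f ω) k h
          (bellman M h (f k ω (h + 1))) (f k ω (h + 1)) :=
    ciInf_le (f := fun g : G h =>
      loss M (fun i h => s i h ω) (action greedy s f ω) k h g (f k ω (h + 1)))
      ⟨0, by
        rintro _ ⟨g, rfl⟩
        exact Finset.sum_nonneg fun _ _ => sq_nonneg _⟩ ⟨_, hs.bellman_mem hF hh⟩
  have h4 := (hc k hk h hh).1 _ hF
  unfold logWeight at h4
  rw [Finset.sum_add_distrib, Finset.sum_add_distrib, Finset.sum_neg_distrib,
    ← Finset.sum_div, ← Finset.sum_div] at h4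
  have h5 : 0 ≤ ∑ t ∈ Finset.range k, gap M (f k ω h) (f k ω) h (visit greedy s f t h ω) ^ 2 :=
    Finset.sum_nonneg fun _ _ => sq_nonneg _
  have h6 : 0 ≤ ∑ t ∈ Finset.range k, meanSqGap M greedy (f k ω h) (f k ω) h (f t ω) :=
    Finset.sum_nonneg fun _ _ => meanSqGap_nonneg _ _ _ _
  -- Since the total excess is at most `β`, `h4` gives `(∑ gap²)/4 + (∑ meanSqGap)/5 ≤ β + b`; the
  -- factor 5 serves both nonnegative sums.
  constructor
  · change ∑ t ∈ Finset.range k, gap M (f k ω h) (f k ω) h (visit greedy s f t h ω) ^ 2 ≤ _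
    linarith
  · linarith

end Good

end

/-! ### Markov's inequality for the drawn policy. -/

section Output

variable {Ω : Type*} [MeasurableSpace Ω] {Pr : Measure Ω} [IsProbabilityMeasure Pr]

theorem lintegral_uniformOn_univ {K : ℕ} (g : Fin K → ENNReal) :
    ∫⁻ j, g j ∂(uniformOn (Set.univ : Set (Fin K))) = (K : ENNReal)⁻¹ * ∑ j, g j := by
  rw [uniformOn, ProbabilityTheory.cond, lintegral_smul_measure, Measure.restrict_univ,
    lintegral_count, tsum_fintype, Measure.count_univ]
  simp

/-- Markov's inequality for a uniformly drawn index. -/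
theorem half_le_prod_uniformOn {K : ℕ} (hK : 0 < K) {R : ℕ → Ω → ℝ} {η : ℝ} (hη : 0 < η)
    (hR : ∀ k < K, Measurable (R k))
    (hle : ∑ k ∈ Finset.range K, ∫⁻ ω, ENNReal.ofReal (R k ω) ∂Pr
      ≤ ENNReal.ofReal (K * (η / 2))) :
    1 / 2 ≤ (Pr.prod (uniformOn (Set.univ : Set (Fin K)))) {p | R p.2 p.1 ≤ η} := by
  have : Nonempty (Fin K) := ⟨⟨0, hK⟩⟩
  have hU : IsProbabilityMeasure (uniformOn (Set.univ : Set (Fin K))) :=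
    isProbabilityMeasure_uniformOn Set.finite_univ Set.univ_nonempty
  set μ := Pr.prod (uniformOn (Set.univ : Set (Fin K))) with hμ
  have hm : Measurable fun p : Ω × Fin K => R p.2 p.1 :=
    measurable_from_prod_countable_left fun j => hR j j.2
  have hKpos : (0 : ℝ) < K := by exact_mod_cast hK
  have h1 : ∫⁻ p, ENNReal.ofReal (R p.2 p.1) ∂μ ≤ ENNReal.ofReal (η / 2) := by
    rw [hμ, lintegral_prod_symm' _ hm.ennreal_ofReal, lintegral_uniformOn_univ,
      Fin.sum_univ_eq_sum_range (fun k => ∫⁻ ω, ENNReal.ofReal (R k ω) ∂Pr)]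
    refine (mul_le_mul_right hle _).trans (le_of_eq ?_)
    rw [ENNReal.ofReal_mul hKpos.le, ENNReal.ofReal_natCast, ← mul_assoc,
      ENNReal.inv_mul_cancel (by exact_mod_cast hK.ne') (ENNReal.natCast_ne_top K), one_mul]
  have h2 := mul_meas_ge_le_lintegral₀ (μ := μ) hm.ennreal_ofReal.aemeasurable
    (ENNReal.ofReal η)
  have h3 : {p : Ω × Fin K | R p.2 p.1 ≤ η}ᶜ
      ⊆ {p | ENNReal.ofReal η ≤ ENNReal.ofReal (R p.2 p.1)} := fun p hp =>
    ENNReal.ofReal_le_ofReal (not_le.mp (Set.notMem_ofPred_iff.mp hp)).le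
  have h4 : μ {p : Ω × Fin K | R p.2 p.1 ≤ η}ᶜ ≤ 1 / 2 := by
    have h5 := (mul_le_mul_right (measure_mono h3) _).trans (h2.trans h1)
    have h6 : ENNReal.ofReal (η / 2) = ENNReal.ofReal η * (1 / 2) := by
      rw [ENNReal.ofReal_div_of_pos two_pos, ENNReal.ofReal_ofNat, div_eq_mul_inv, one_div]
    rw [h6] at h5
    exact (ENNReal.mul_le_mul_iff_right (by simpa using hη) ENNReal.ofReal_ne_top).mp h5
  have hset : MeasurableSet {p : Ω × Fin K | R p.2 p.1 ≤ η} := hm measurableSet_Iic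
  rw [prob_compl_eq_one_sub hset] at h4
  have h7 : (1 : ENNReal) ≤ 1 / 2 + μ {p : Ω × Fin K | R p.2 p.1 ≤ η} :=
    tsub_le_iff_right.mp h4
  have h8 : (1 / 2 : ENNReal) + 1 / 2 ≤ 1 / 2 + μ {p : Ω × Fin K | R p.2 p.1 ≤ η} :=
    (ENNReal.add_halves 1).le.trans h7
  exact (ENNReal.add_le_add_iff_left (by simp)).mp h8

end Output

/-! ### Expected cumulative regret. -/

section Regret

variable {Ω S A : Type*} [MeasurableSpace S] [MeasurableSpace A] [mΩ : MeasurableSpace Ω]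
  {Pr : Measure Ω} [IsProbabilityMeasure Pr] {M : MDP S A} {F G : ℕ → Set (S × A → ℝ)}
  {greedy : QTuple S A → ℕ → S → A} {K : ℕ} {β : ℝ} {𝓖 : ℕ → ℕ → MeasurableSpace Ω}
  {s : ℕ → ℕ → Ω → S} {f : ℕ → Ω → QTuple S A}

theorem measurable_integral_next {Ω : Type*} [MeasurableSpace Ω] {π : Ω → ℕ → S → A} {h : ℕ}
    (hπ : Measurable fun p : Ω × S => π p.1 h p.2) {g : Ω × S → ℝ} (hg : Measurable g) :
    Measurable fun p : Ω × S => ∫ y, g (p.1, y) ∂M.P h (p.2, π p.1 h p.2) := by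
  have hx : Measurable fun p : Ω × S => (p.2, π p.1 h p.2) := measurable_snd.prodMk hπ
  exact (StronglyMeasurable.integral_kernel_prod_right (κ := (M.P h).comap _ hx)
    (f := fun (p : Ω × S) y => g (p.1, y))
    (Measurable.stronglyMeasurable (by fun_prop))).measurable

theorem measurable_residual_policy {Ω : Type*} [MeasurableSpace Ω] (hs : Setting M F G greedy)
    {q : Ω → QTuple S A} (hq : ∀ ω, q ω ∈ tuples M.H F)
    (hfun : ∀ h < M.H, Measurable fun p : Ω × (S × A) => q p.1 h p.2)
    (hpol : ∀ h < M.H, Measurable fun p : Ω × S => greedy (q p.1) h p.2) {h : ℕ} (hh : h < M.H) :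
    Measurable fun p : Ω × S => residual M (q p.1) h (p.2, greedy (q p.1) h p.2) := by
  have hgr : ∀ h < M.H, Measurable fun p : Ω × S => q p.1 h (p.2, greedy (q p.1) h p.2) :=
    fun h hh => (hfun h hh).comp (measurable_fst.prodMk (measurable_snd.prodMk (hpol h hh)))
  have hsup : Measurable fun p : Ω × S => ⨆ a, q p.1 (h + 1) (p.2, a) := by
    simp_rw [fun p : Ω × S => hs.iSup_eq_greedy (hq p.1) (h + 1) p.2]
    by_cases hh' : h + 1 < M.H
    · exact hgr _ hh'
    · have h0 : ∀ ω, q ω (h + 1) = 0 := fun ω => by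
        have := hq ω (h + 1)
        unfold withTerminal at this
        rwa [if_neg hh'] at this
      simp_rw [h0]
      exact measurable_const
  have hrew : Measurable fun p : Ω × S => M.r h (p.2, greedy (q p.1) h p.2) :=
    (M.measurable_r h).comp (measurable_snd.prodMk (hpol h hh))
  exact (hgr h hh).sub (hrew.add (measurable_integral_next
    (π := fun ω => greedy (q ω)) (hpol h hh) hsup))

/-- The suboptimality of the greedy policy of `q`. -/
def regret (M : MDP S A) (greedy : QTuple S A → ℕ → S → A) (q : QTuple S A) : ℝ :=
  vStar M 0 M.s₁ - value M (greedy q) 0 M.s₁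

/-- The expected Bellman residual of `q` at step `h` along its greedy policy. -/
def meanResidual (M : MDP S A) (greedy : QTuple S A → ℕ → S → A) (h : ℕ) (q : QTuple S A) : ℝ :=
  ∫ x, residual M q h x ∂occupancy M (greedy q) h

namespace Setting

variable (hs : Setting M F G greedy)
include hs

theorem regret_mem_Icc {q : QTuple S A} (hq : q ∈ tuples M.H F) :
    regret M greedy q ∈ Set.Icc (0 : ℝ) 1 := by
  have hπ := hs.measurable_greedy hq
  have h1 := hs.value_le_vStar hπ
  have h2 := (value_mem_Icc hs.reward_le_one hπ 0 M.s₁).1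
  have h3 := hs.vStar_le_one
  unfold regret
  exact ⟨by linarith, by linarith⟩

theorem meanResidual_mem_Icc {q : QTuple S A} (hq : q ∈ tuples M.H F) {h : ℕ} (hh : h < M.H) :
    meanResidual M greedy h q ∈ Set.Icc (-1 : ℝ) 1 := by
  have := Setting.isProbabilityMeasure_occupancy (M := M) (hs.measurable_greedy hq) h
  exact integral_mem_Icc (hs.measurable_residual hq hh).aemeasurable (hs.residual_mem_Icc hq hh)

end Setting

namespace IsRun

variable (run : IsRun Pr M F G greedy K β 𝓖 s f) (hs : Setting M F G greedy)
include run hs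

omit [IsProbabilityMeasure Pr] in
theorem measurable_residual_greedy {k h : ℕ} (hk : k < K) (hh : h < M.H) :
    Measurable[(𝓖 k 0).prod inferInstance] fun p : Ω × S =>
      residual M (f k p.1) h (p.2, greedy (f k p.1) h p.2) :=
  @measurable_residual_policy S A _ _ M F G greedy Ω (𝓖 k 0) hs (f k) (run.mem k hk)
    (run.measurable_fun k hk) (run.measurable_policy k hk) h hh

omit [IsProbabilityMeasure Pr] hs in
theorem prod_le {k : ℕ} :
    (𝓖 k 0).prod (inferInstance : MeasurableSpace S) ≤ mΩ.prod inferInstance :=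
  sup_le_sup (MeasurableSpace.comap_mono (run.le k 0)) le_rfl

omit [IsProbabilityMeasure Pr] hs in
theorem measurable_policy_ambient {k : ℕ} (hk : k < K) : ∀ h < M.H,
    Measurable fun p : Ω × S => greedy (f k p.1) h p.2 := fun h hh =>
  (run.measurable_policy k hk h hh).mono run.prod_le le_rfl

omit [IsProbabilityMeasure Pr] hs in
theorem measurable_regret {k : ℕ} (hk : k < K) : Measurable fun ω => regret M greedy (f k ω) := by
  unfold regret value
  refine measurable_const.sub (Finset.measurable_fun_sum _ fun n hn => ?_)
  have hn : n < M.H := by simpa using Finset.mem_range.mp hn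
  simp only [zero_add]
  have hpol := run.measurable_policy_ambient hk
  exact measurable_integral_stateLaw (π := fun ω => greedy (f k ω)) hpol M.s₁ hn.le
    (g := fun p => M.r n (p.2, greedy (f k p.1) n p.2))
    ((M.measurable_r n).comp (measurable_snd.prodMk (hpol n hn))) fun _ => M.r_nonneg _ _

omit [IsProbabilityMeasure Pr] in
theorem measurable_residual_visit {k h : ℕ} (hk : k < K) (hh : h < M.H) :
    Measurable fun ω => residual M (f k ω) h (visit greedy s f k h ω) :=
  ((run.measurable_residual_greedy hs hk hh).mono run.prod_le le_rfl).comp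
    (measurable_id.prodMk ((run.measurable_state k hk h hh.le).mono (run.le k h) le_rfl))

omit [IsProbabilityMeasure Pr] in
-- Adding one makes the integrand nonnegative, so the results stated for Lebesgue integrals apply to
-- the signed residual.
theorem meanResidual_add_one {k h : ℕ} (hk : k < K) (hh : h < M.H) (ω : Ω) :
    meanResidual M greedy h (f k ω) + 1
      = ∫ y, (residual M (f k ω) h (y, greedy (f k ω) h y) + 1)
          ∂stateLaw M (greedy (f k ω)) 0 M.s₁ h := by
  have hq := run.mem k hk ω
  have hπ := hs.measurable_greedy hq
  have := isProbabilityMeasure_stateLaw (M := M) hπ 0 M.s₁ h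
  have hm : Measurable fun y => residual M (f k ω) h (y, greedy (f k ω) h y) :=
    (hs.measurable_residual hq hh).comp (measurable_id.prodMk (hπ h))
  rw [integral_add (Integrable.of_mem_Icc (-1) 1 hm.aemeasurable
    (ae_of_all _ fun y => hs.residual_mem_Icc hq hh _)) (integrable_const _), meanResidual,
    Setting.integral_occupancy hπ h (hs.measurable_residual hq hh)]
  simp

omit [IsProbabilityMeasure Pr] in
theorem measurable_meanResidual {k h : ℕ} (hk : k < K) (hh : h < M.H) :
    Measurable fun ω => meanResidual M greedy h (f k ω) := by
  have h1 : ∀ ω, meanResidual M greedy h (f k ω)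
      = ∫ y, (residual M (f k ω) h (y, greedy (f k ω) h y) + 1)
          ∂stateLaw M (greedy (f k ω)) 0 M.s₁ h - 1 := fun ω => by
    rw [← run.meanResidual_add_one hs hk hh ω]
    ring
  simp_rw [h1]
  refine Measurable.sub_const ?_ 1
  refine measurable_integral_stateLaw (π := fun ω => greedy (f k ω))
    (run.measurable_policy_ambient hk) M.s₁ hh.le
    (g := fun p => residual M (f k p.1) h (p.2, greedy (f k p.1) h p.2) + 1)
    (((run.measurable_residual_greedy hs hk hh).mono run.prod_le le_rfl).add_const 1) ?_
  intro p
  have := (hs.residual_mem_Icc (run.mem k hk p.1) hh (p.2, greedy (f k p.1) h p.2)).1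
  linarith

omit [IsProbabilityMeasure Pr] in
theorem residual_visit_mem_Icc {k h : ℕ} (hk : k < K) (hh : h < M.H) (ω : Ω) :
    residual M (f k ω) h (visit greedy s f k h ω) ∈ Set.Icc (-1 : ℝ) 1 :=
  hs.residual_mem_Icc (run.mem k hk ω) hh _

theorem integrable_meanResidual {k h : ℕ} (hk : k < K) (hh : h < M.H) :
    Integrable (fun ω => meanResidual M greedy h (f k ω)) Pr :=
  Integrable.of_mem_Icc (-1) 1 (run.measurable_meanResidual hs hk hh).aemeasurable
    (ae_of_all _ fun ω => hs.meanResidual_mem_Icc (run.mem k hk ω) hh)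

theorem integrable_residual_visit {k h : ℕ} (hk : k < K) (hh : h < M.H) :
    Integrable (fun ω => residual M (f k ω) h (visit greedy s f k h ω)) Pr :=
  Integrable.of_mem_Icc (-1) 1 (run.measurable_residual_visit hs hk hh).aemeasurable
    (ae_of_all _ fun ω => run.residual_visit_mem_Icc hs hk hh ω)

theorem integrable_regret {k : ℕ} (hk : k < K) :
    Integrable (fun ω => regret M greedy (f k ω)) Pr :=
  Integrable.of_mem_Icc 0 1 (run.measurable_regret hk).aemeasurable
    (ae_of_all _ fun ω => hs.regret_mem_Icc (run.mem k hk ω))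

/-- `f^k` is fixed before episode `k`, and given that past the visited state has exactly the law of
the integral on the left. -/
theorem integral_meanResidual {k h : ℕ} (hk : k < K) (hh : h < M.H) :
    ∫ ω, meanResidual M greedy h (f k ω) ∂Pr
      = ∫ ω, residual M (f k ω) h (visit greedy s f k h ω) ∂Pr := by
  have hi1 := run.integrable_meanResidual hs hk hh
  have hi2 := run.integrable_residual_visit hs hk hh
  suffices hsuff : ∫ ω, (meanResidual M greedy h (f k ω) + 1) ∂Pr
      = ∫ ω, (residual M (f k ω) h (visit greedy s f k h ω) + 1) ∂Pr by
    rw [integral_add hi1 (integrable_const _), integral_add hi2 (integrable_const _)] at hsuff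
    linarith
  have hn1 : ∀ ω, 0 ≤ meanResidual M greedy h (f k ω) + 1 := fun ω => by
    linarith [(hs.meanResidual_mem_Icc (run.mem k hk ω) hh).1]
  have hn2 : ∀ ω, 0 ≤ residual M (f k ω) h (visit greedy s f k h ω) + 1 := fun ω => by
    linarith [(run.residual_visit_mem_Icc hs hk hh ω).1]
  rw [integral_eq_lintegral_of_nonneg_ae (ae_of_all _ hn1)
      (hi1.add (integrable_const _)).aestronglyMeasurable,
    integral_eq_lintegral_of_nonneg_ae (ae_of_all _ hn2)
      (hi2.add (integrable_const _)).aestronglyMeasurable]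
  congr 1
  have h1 := run.lintegral_state hk h hh.le
    (g := fun p => ENNReal.ofReal (residual M (f k p.1) h (p.2, greedy (f k p.1) h p.2) + 1))
    ((run.measurable_residual_greedy hs hk hh).add_const 1).ennreal_ofReal
  refine Eq.trans (lintegral_congr fun ω => ?_) h1.symm
  have hq := run.mem k hk ω
  have hπ := hs.measurable_greedy hq
  have := isProbabilityMeasure_stateLaw (M := M) hπ 0 M.s₁ h
  have hm := (hs.measurable_residual hq hh).comp (measurable_id.prodMk (hπ h))
  rw [run.meanResidual_add_one hs hk hh ω]
  refine ofReal_integral_eq_lintegral_ofReal ?_ (ae_of_all _ fun y => ?_)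
  · exact (Integrable.of_mem_Icc (-1) 1 hm.aemeasurable
      (ae_of_all _ fun y => hs.residual_mem_Icc hq hh _)).add (integrable_const _)
  · have := (hs.residual_mem_Icc hq hh (y, greedy (f k ω) h y)).1
    simp only [Pi.zero_apply]
    linarith

omit [IsProbabilityMeasure Pr] in
theorem regret_le_sum_meanResidual {b : ℝ} (hb : b ≤ β) {ω : Ω}
    (hc : Concentrated M F G greedy K s f b ω) {k : ℕ} (hk : k < K) :
    regret M greedy (f k ω) ≤ ∑ h ∈ Finset.range M.H, meanResidual M greedy h (f k ω) := by
  have hmem := hs.qStarTuple_mem_confSet hb hc hk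
  have h1 := (run.optimistic k hk ω ⟨_, hmem⟩).2 _ hmem
  have h2 := hs.vStar_le
  have h3 := hs.sub_value_eq_sum_residual (run.mem k hk ω)
  unfold meanResidual regret
  rw [← h3]
  linarith

omit [IsProbabilityMeasure Pr] in
theorem sum_meanResidual_le {b : ℝ} (hb : b ≤ β) (hb0 : 0 ≤ β + b) {ω : Ω}
    (hc : Concentrated M F G greedy K s f b ω) {h : ℕ} (hh : h < M.H) {η : ℝ} (hη : 0 < η) {d : ℕ}
    (hd : dimDE (residuals M F h) (greedyFamily M F greedy h) η ≤ d) :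
    ∑ k ∈ Finset.range K, meanResidual M greedy h (f k ω)
      ≤ K * η + d + 2 * √(d * (5 * (β + b)) * K) := by
  refine le_trans (Finset.sum_le_sum fun k _ => le_abs_self _)
    (sum_abs_integral_le_of_dimDE hη (by positivity) hd
      (fun k => residual M (f k ω) h) (fun k => occupancy M (greedy (f k ω)) h)
      (fun k hk => ⟨f k ω, run.mem k hk ω, rfl⟩) (fun k hk => ⟨f k ω, run.mem k hk ω, rfl⟩) ?_ ?_)
  · intro k hk
    exact abs_le.mpr (hs.meanResidual_mem_Icc (run.mem k hk ω) hh)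
  · intro k hk
    refine le_trans (Finset.sum_le_sum fun t ht => ?_) (run.sum_gap_le hs hb hc hk hh).2
    have htK : t < K := (Finset.mem_range.mp ht).trans hk
    have hπ := hs.measurable_greedy (run.mem t htK ω)
    have hm := hs.measurable_residual (run.mem k hk ω) hh
    have := Setting.isProbabilityMeasure_occupancy (M := M) hπ h
    refine (sq_integral_le hm.aemeasurable (hs.abs_residual_le (run.mem k hk ω) hh)).trans
      (le_of_eq ?_)
    exact Setting.integral_occupancy hπ h (hm.pow_const 2)

omit [IsProbabilityMeasure Pr] in
theorem sum_residual_visit_le {b : ℝ} (hb : b ≤ β) (hb0 : 0 ≤ β + b) {ω : Ω}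
    (hc : Concentrated M F G greedy K s f b ω) {h : ℕ} (hh : h < M.H) {η : ℝ} (hη : 0 < η) {d : ℕ}
    (hd : dimDE (residuals M F h) (diracFamily S A h) η ≤ d) :
    ∑ k ∈ Finset.range K, residual M (f k ω) h (visit greedy s f k h ω)
      ≤ K * η + d + 2 * √(d * (5 * (β + b)) * K) := by
  have hdir : ∀ k < K, ∀ t, ∫ x, residual M (f k ω) h x ∂Measure.dirac (visit greedy s f t h ω)
      = residual M (f k ω) h (visit greedy s f t h ω) := fun k hk t =>
    integral_dirac' _ _ (hs.measurable_residual (run.mem k hk ω) hh).stronglyMeasurable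
  have key := sum_abs_integral_le_of_dimDE hη (b := 5 * (β + b)) (K := K) (by positivity) hd
      (fun k => residual M (f k ω) h) (fun k => Measure.dirac (visit greedy s f k h ω))
      (fun k hk => ⟨f k ω, run.mem k hk ω, rfl⟩) (fun k hk => ⟨_, rfl⟩)
      (fun k hk => by
        rw [hdir k hk k]
        exact hs.abs_residual_le (run.mem k hk ω) hh _)
      (fun k hk => by
        simp_rw [hdir k hk]
        exact (run.sum_gap_le hs hb hc hk hh).1)
  refine le_trans (Finset.sum_le_sum fun k hk => ?_) key
  rw [hdir k (Finset.mem_range.mp hk) k]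
  exact le_abs_self _

/-- The expected cumulative regret. -/
theorem sum_integral_regret_le {b : ℝ} (hb : b ≤ β) (hb0 : 0 ≤ β + b) {B : Set Ω}
    (hB : MeasurableSet B) (hgood : ∀ ω ∉ B, Concentrated M F G greedy K s f b ω)
    {η : ℝ} (hη : 0 < η) {d : ℕ}
    (hd : dimBE M F (diracFamily S A) η ≤ d ∨ dimBE M F (greedyFamily M F greedy) η ≤ d) :
    ∑ k ∈ Finset.range K, ∫ ω, regret M greedy (f k ω) ∂Pr
      ≤ M.H * (K * η + d + 2 * √(d * (5 * (β + b)) * K)) + 3 * M.H * K * Pr.real B := by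
  set R := K * η + d + 2 * √(d * (5 * (β + b)) * K) with hR
  have hR0 : 0 ≤ R := by positivity
  have hH1 : (1 : ℝ) ≤ M.H := by exact_mod_cast hs.pos
  have hind : Integrable (B.indicator fun _ => (1 : ℝ)) Pr :=
    (integrable_const _).indicator hB
  have hindint : ∫ ω, B.indicator (fun _ => (1 : ℝ)) ω ∂Pr = Pr.real B := by
    rw [integral_indicator hB]
    simp
  have hK0 : (0 : ℝ) ≤ K := Nat.cast_nonneg _
  have hP0 : 0 ≤ Pr.real B := measureReal_nonneg
  -- With Dirac measures, expected residuals must be exchanged for visited ones under the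
  -- expectation before the Eluder bound; with the greedy family the bound holds outcome by outcome.
  rcases hd with hd | hd
  · have hd' : ∀ h < M.H, dimDE (residuals M F h) (diracFamily S A h) η ≤ d := fun h hh =>
      (le_iSup₂ (f := fun h (_ : h < M.H) => dimDE (residuals M F h) (diracFamily S A h) η)
        h hh).trans hd
    -- On `B` the residual sum may be as low as `-H` while the regret is at most one; since `H ≥ 1`,
    -- a correction of `2H` suffices.
    have hpt : ∀ k < K, ∀ ω, regret M greedy (f k ω)
        ≤ ∑ h ∈ Finset.range M.H, meanResidual M greedy h (f k ω)
          + 2 * M.H * B.indicator (fun _ => (1 : ℝ)) ω := by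
      intro k hk ω
      by_cases hω : ω ∈ B
      · rw [Set.indicator_of_mem hω]
        have h1 := (hs.regret_mem_Icc (run.mem k hk ω)).2
        have h2 : ∑ h ∈ Finset.range M.H, (-1 : ℝ)
            ≤ ∑ h ∈ Finset.range M.H, meanResidual M greedy h (f k ω) :=
          Finset.sum_le_sum fun h hh =>
            (hs.meanResidual_mem_Icc (run.mem k hk ω) (Finset.mem_range.mp hh)).1
        simp only [Finset.sum_const, Finset.card_range, nsmul_eq_mul] at h2
        linarith
      · rw [Set.indicator_of_notMem hω, mul_zero, add_zero]
        exact run.regret_le_sum_meanResidual hs hb (hgood ω hω) hk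
    have h1 : ∀ k ∈ Finset.range K, ∫ ω, regret M greedy (f k ω) ∂Pr
        ≤ ∑ h ∈ Finset.range M.H, ∫ ω, residual M (f k ω) h (visit greedy s f k h ω) ∂Pr
          + 2 * M.H * Pr.real B := by
      intro k hk
      have hk := Finset.mem_range.mp hk
      have hiD : Integrable (fun ω => ∑ h ∈ Finset.range M.H, meanResidual M greedy h (f k ω)) Pr :=
        integrable_finsetSum _ fun h hh =>
          run.integrable_meanResidual hs hk (Finset.mem_range.mp hh)
      refine (integral_mono (run.integrable_regret hs hk) (hiD.add (hind.const_mul _))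
        (hpt k hk)).trans (le_of_eq ?_)
      rw [integral_add' hiD (hind.const_mul _), integral_const_mul, hindint,
        integral_finsetSum _ fun h hh =>
          run.integrable_meanResidual hs hk (Finset.mem_range.mp hh)]
      congr 1
      exact Finset.sum_congr rfl fun h hh =>
        run.integral_meanResidual hs hk (Finset.mem_range.mp hh)
    have h2 : ∀ h ∈ Finset.range M.H,
        ∑ k ∈ Finset.range K, ∫ ω, residual M (f k ω) h (visit greedy s f k h ω) ∂Pr
          ≤ R + K * Pr.real B := by
      intro h hh
      have hh := Finset.mem_range.mp hh
      have hiU : ∀ k ∈ Finset.range K,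
          Integrable (fun ω => residual M (f k ω) h (visit greedy s f k h ω)) Pr := fun k hk =>
        run.integrable_residual_visit hs (Finset.mem_range.mp hk) hh
      rw [← integral_finsetSum _ hiU]
      have hpt2 : ∀ ω, ∑ k ∈ Finset.range K, residual M (f k ω) h (visit greedy s f k h ω)
          ≤ R + K * B.indicator (fun _ => (1 : ℝ)) ω := by
        intro ω
        by_cases hω : ω ∈ B
        · rw [Set.indicator_of_mem hω]
          have h3 : ∑ k ∈ Finset.range K, residual M (f k ω) h (visit greedy s f k h ω)
              ≤ ∑ k ∈ Finset.range K, (1 : ℝ) := Finset.sum_le_sum fun k hk =>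
            (run.residual_visit_mem_Icc hs (Finset.mem_range.mp hk) hh ω).2
          simp only [Finset.sum_const, Finset.card_range, nsmul_eq_mul] at h3
          linarith
        · rw [Set.indicator_of_notMem hω, mul_zero, add_zero]
          exact run.sum_residual_visit_le hs hb hb0 (hgood ω hω) hh hη (hd' h hh)
      refine (integral_mono (integrable_finsetSum _ hiU)
        ((integrable_const _).add (hind.const_mul _)) hpt2).trans (le_of_eq ?_)
      rw [integral_add' (integrable_const _) (hind.const_mul _), integral_const_mul, hindint]
      simp
    refine (Finset.sum_le_sum h1).trans ?_
    rw [Finset.sum_add_distrib, Finset.sum_comm]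
    have h3 := Finset.sum_le_sum h2
    simp only [Finset.sum_const, Finset.card_range, nsmul_eq_mul] at h3 ⊢
    linarith
  · have hd' : ∀ h < M.H, dimDE (residuals M F h) (greedyFamily M F greedy h) η ≤ d := fun h hh =>
      (le_iSup₂ (f := fun h (_ : h < M.H) =>
        dimDE (residuals M F h) (greedyFamily M F greedy h) η) h hh).trans hd
    have hiR : ∀ k ∈ Finset.range K, Integrable (fun ω => regret M greedy (f k ω)) Pr :=
      fun k hk => run.integrable_regret hs (Finset.mem_range.mp hk)
    rw [← integral_finsetSum _ hiR]
    have hpt : ∀ ω, ∑ k ∈ Finset.range K, regret M greedy (f k ω)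
        ≤ M.H * R + K * B.indicator (fun _ => (1 : ℝ)) ω := by
      intro ω
      by_cases hω : ω ∈ B
      · rw [Set.indicator_of_mem hω]
        have h3 : ∑ k ∈ Finset.range K, regret M greedy (f k ω) ≤ ∑ k ∈ Finset.range K, (1 : ℝ) :=
          Finset.sum_le_sum fun k hk =>
            (hs.regret_mem_Icc (run.mem k (Finset.mem_range.mp hk) ω)).2
        simp only [Finset.sum_const, Finset.card_range, nsmul_eq_mul] at h3
        nlinarith
      · rw [Set.indicator_of_notMem hω, mul_zero, add_zero]
        refine (Finset.sum_le_sum fun k hk => run.regret_le_sum_meanResidual hs hb (hgood ω hω)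
          (Finset.mem_range.mp hk)).trans ?_
        rw [Finset.sum_comm]
        have h3 := Finset.sum_le_sum fun h (hh : h ∈ Finset.range M.H) =>
          run.sum_meanResidual_le hs hb hb0 (hgood ω hω) (Finset.mem_range.mp hh) hη
            (hd' h (Finset.mem_range.mp hh))
        rwa [Finset.sum_const, Finset.card_range, nsmul_eq_mul] at h3
    refine (integral_mono (integrable_finsetSum _ hiR)
      ((integrable_const _).add (hind.const_mul _)) hpt).trans ?_
    rw [integral_add' (integrable_const _) (hind.const_mul _),
      integral_const_mul (K : ℝ), hindint]
    simp only [integral_const, probReal_univ, smul_eq_mul, one_mul]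
    have h4 : (K : ℝ) * Pr.real B ≤ M.H * (K * Pr.real B) :=
      le_mul_of_one_le_left (by positivity) hH1
    have h5 : 0 ≤ M.H * (K * Pr.real B) := by positivity
    linarith

end IsRun

end Regret

/-! ### Consequences of `K ≥ L` for `ε ≤ 1/2`. -/

section Numerics

variable {H d N K ε : ℝ} (hH : 1 ≤ H) (hd : 1 ≤ d) (hN : 1 ≤ N) (hε : 0 < ε) (hε2 : ε ≤ 1 / 2)
include hH hd hN hε hε2

theorem two_le_size : 2 ≤ N * (H * d / ε) := by
  have h1 : 2 ≤ H * d / ε := by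
    rw [le_div_iff₀ hε]
    nlinarith
  nlinarith

variable (hL : H ^ 2 * d / ε ^ 2 * Real.log (N * (H * d / ε)) ≤ K)
include hL

theorem sq_mul_le_episodes : H ^ 2 * d / ε ^ 2 ≤ 2 * K := by
  have h1 : (1 / 2 : ℝ) ≤ Real.log (N * (H * d / ε)) := by
    have h2 := Real.log_le_log two_pos (two_le_size hH hd hN hε hε2)
    linarith [Real.log_two_gt_d9]
  have h2 : H ^ 2 * d / ε ^ 2 * (1 / 2) ≤ H ^ 2 * d / ε ^ 2 * Real.log (N * (H * d / ε)) :=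
    mul_le_mul_of_nonneg_left h1 (by positivity)
  linarith

theorem mul_le_episodes_mul : H * d ≤ K * ε := by
  have h1 := sq_mul_le_episodes hH hd hN hε hε2 hL
  rw [div_le_iff₀ (by positivity)] at h1
  have h2 : H * d ≤ H ^ 2 * d := by
    nlinarith [mul_le_mul_of_nonneg_right hH (by positivity : 0 ≤ H * d)]
  have h3 : 0 < K := by
    by_contra hK
    have : 2 * K * ε ^ 2 ≤ 0 := by
      have : 0 < ε ^ 2 := by positivity
      nlinarith
    have : 0 < H ^ 2 * d := by positivity
    linarith
  have h4 : 2 * K * ε ^ 2 ≤ K * ε := by nlinarith [mul_pos h3 hε]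
  linarith

theorem two_le_episodes : 2 ≤ K := by
  have h1 := mul_le_episodes_mul hH hd hN hε hε2 hL
  nlinarith

theorem log_size_le_log_episodes :
    Real.log (N * (H * d / ε)) ≤ Real.log (N * (H * K)) := by
  have h1 := mul_le_episodes_mul hH hd hN hε hε2 hL
  refine Real.log_le_log (by positivity) ?_
  have h2 : H * d / ε ≤ K := by rwa [div_le_iff₀ hε]
  have h3 : K ≤ H * K := by
    have := two_le_episodes hH hd hN hε hε2 hL
    nlinarith
  exact mul_le_mul_of_nonneg_left (h2.trans h3) (by linarith)

/-- With `q = 1/ρ`, write `N H K = (N H q)(K/q)`. The first factor is at most `(N H d/ε)³`, whose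
logarithm is at most `3K/q` by `K ≥ L`; the second uses `log t ≤ t`. -/
theorem log_episodes_le : Real.log (N * (H * K)) ≤ 4 * (K * (ε ^ 2 / (H ^ 2 * d))) := by
  have hK := two_le_episodes hH hd hN hε hε2 hL
  set q := H ^ 2 * d / ε ^ 2 with hq
  have hq0 : 0 < q := by positivity
  have hqinv : K * (ε ^ 2 / (H ^ 2 * d)) = K / q := by
    rw [hq]
    field_simp
  have h1 : N * (H * K) = (N * H * q) * (K / q) := by field_simp
  have h2 : N * H * q ≤ (N * (H * d / ε)) ^ 3 := by
    have e1 : (N * (H * d / ε)) ^ 3 = N * H * q * (N ^ 2 * d ^ 2 / ε) := by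
      rw [hq]
      field_simp
    rw [e1]
    refine le_mul_of_one_le_right (by positivity) ?_
    rw [one_le_div hε]
    have : 1 ≤ N ^ 2 * d ^ 2 := by
      have a1 : 1 ≤ N ^ 2 := one_le_pow₀ hN
      have a2 : 1 ≤ d ^ 2 := one_le_pow₀ hd
      nlinarith
    linarith
  have h3 : Real.log (N * H * q) ≤ 3 * Real.log (N * (H * d / ε)) := by
    have := Real.log_le_log (by positivity) h2
    rwa [Real.log_pow] at this
  have h4 : Real.log (K / q) ≤ K / q := by
    have := Real.log_le_sub_one_of_pos (div_pos (by linarith : 0 < K) hq0)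
    linarith
  have h5 : Real.log (N * (H * d / ε)) ≤ K / q := by
    rw [le_div_iff₀ hq0]
    linarith
  rw [hqinv, h1, Real.log_mul (by positivity) (div_pos (by linarith) hq0).ne']
  linarith

end Numerics

theorem two_mul_mul_exp_neg_log_le {x K : ℝ} (hK : 2 ≤ K) (hx : K ≤ x) :
    2 * x * Real.exp (-(3 * Real.log x)) ≤ 1 / K := by
  have hx0 : 0 < x := by linarith
  have h1 : Real.exp (-(3 * Real.log x)) = (x ^ 3)⁻¹ := by
    rw [Real.exp_neg, mul_comm, Real.exp_mul, Real.exp_log hx0]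
    norm_cast
  rw [h1, ← div_eq_mul_inv, div_le_div_iff₀ (by positivity) (by linarith)]
  have h2 : 2 * K ≤ x ^ 2 := by nlinarith
  nlinarith

/-- The level of the confidence sets lies between two multiples of `log (N H K) + K ρ`. -/
theorem confidence_level_bounds {m ℓ logK Kρ β : ℝ} (hm : 1 ≤ m) (hlog : ℓ ≤ logK) (h0 : 0 ≤ logK)
    (hKρ : 0 ≤ Kρ) (hβ : β = 28 * (1 + m) * (logK + Kρ) ∨
      (Kρ ≤ m * ℓ ∧ β = 28 * (1 + m) * logK)) :
    28 * (logK + Kρ) ≤ β ∧ β ≤ 28 * (1 + m) * (logK + Kρ) := by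
  rcases hβ with rfl | ⟨h1, rfl⟩
  · exact ⟨by nlinarith, le_rfl⟩
  · exact ⟨by nlinarith, by nlinarith⟩

/-! ### Assembly of the estimates. -/

section Main

variable {Ω S A : Type*} [MeasurableSpace S] [MeasurableSpace A] [MeasurableSpace Ω]
  {Pr : Measure Ω} [IsProbabilityMeasure Pr] {M : MDP S A} {F G : ℕ → Set (S × A → ℝ)}
  {greedy : QTuple S A → ℕ → S → A} {K : ℕ} {β : ℝ} {𝓖 : ℕ → ℕ → MeasurableSpace Ω}
  {s : ℕ → ℕ → Ω → S} {f : ℕ → Ω → QTuple S A}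

theorem Setting.one_le_coverNum (hs : Setting M F G greedy) {ρ : ℝ} {N : ℕ}
    (hN : (N : ℕ∞) = coverNum (tuples M.H F ∪ tuples M.H G) ρ) : 1 ≤ N := by
  obtain ⟨D, hD, _, hcov⟩ := exists_inner_cover hN subset_rfl
  obtain ⟨g, hg, _⟩ := hcov _ (Or.inl hs.qStarTuple_mem)
  exact (Finset.card_pos.mpr ⟨g, hg⟩).trans_le hD

theorem probOptimal_eq_one_of_one_le (run : IsRun Pr M F G greedy K β 𝓖 s f)
    (hs : Setting M F G greedy) (hK : 1 ≤ K) {η : ℝ} (hη : 1 ≤ η) :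
    probOptimal Pr M greedy K f η = 1 := by
  have : Nonempty (Fin K) := ⟨⟨0, hK⟩⟩
  have hU : IsProbabilityMeasure (uniformOn (Set.univ : Set (Fin K))) :=
    isProbabilityMeasure_uniformOn Set.finite_univ Set.univ_nonempty
  have huniv : {p : Ω × Fin K | vStar M 0 M.s₁ - η ≤ value M (greedy (f p.2 p.1)) 0 M.s₁}
      = Set.univ := by
    refine Set.eq_univ_of_forall fun p => ?_
    have h1 := (hs.regret_mem_Icc (run.mem p.2 p.2.2 p.1)).2
    unfold regret at h1
    change vStar M 0 M.s₁ - η ≤ value M (greedy (f p.2 p.1)) 0 M.s₁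
    linarith
  rw [probOptimal, huniv, measure_univ]

theorem half_le_probOptimal_of_sum_regret (run : IsRun Pr M F G greedy K β 𝓖 s f)
    (hs : Setting M F G greedy) (hK : 1 ≤ K) {η : ℝ} (hη : 0 < η)
    (hle : ∑ k ∈ Finset.range K, ∫ ω, regret M greedy (f k ω) ∂Pr ≤ K * (η / 2)) :
    1 / 2 ≤ probOptimal Pr M greedy K f η := by
  have h1 := half_le_prod_uniformOn (Pr := Pr) hK (R := fun k ω => regret M greedy (f k ω)) hη
    (fun k hk => run.measurable_regret hk) (by
      have h2 : ∀ k ∈ Finset.range K, ∫⁻ ω, ENNReal.ofReal (regret M greedy (f k ω)) ∂Pr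
          = ENNReal.ofReal (∫ ω, regret M greedy (f k ω) ∂Pr) := fun k hk =>
        (ofReal_integral_eq_lintegral_ofReal
          (run.integrable_regret hs (Finset.mem_range.mp hk)) (ae_of_all _ fun ω =>
            (hs.regret_mem_Icc (run.mem k (Finset.mem_range.mp hk) ω)).1)).symm
      rw [Finset.sum_congr rfl h2, ← ENNReal.ofReal_sum_of_nonneg fun k hk =>
        integral_nonneg fun ω => (hs.regret_mem_Icc (run.mem k (Finset.mem_range.mp hk) ω)).1]
      exact ENNReal.ofReal_le_ofReal hle)
  refine h1.trans (measure_mono fun p hp => ?_)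
  have hp' : regret M greedy (f p.2 p.1) ≤ η := hp
  unfold regret at hp'
  change vStar M 0 M.s₁ - η ≤ value M (greedy (f p.2 p.1)) 0 M.s₁
  linarith

theorem IsRun.half_le_probOptimal (run : IsRun Pr M F G greedy K β 𝓖 s f)
    (hs : Setting M F G greedy) {m ε : ℝ} (hm : 1 ≤ m) (hε : 0 < ε) (hε2 : ε ≤ 1 / 2)
    {d N : ℕ} (hd1 : 1 ≤ d)
    (hd : dimBE M F (diracFamily S A) (ε / M.H) ≤ d ∨
      dimBE M F (greedyFamily M F greedy) (ε / M.H) ≤ d)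
    (hN : (N : ℕ∞) = coverNum (tuples M.H F ∪ tuples M.H G) (ε ^ 2 / (M.H ^ 2 * d)))
    (hK : 1 ≤ K) (hL : M.H ^ 2 * d / ε ^ 2 * Real.log (N * (M.H * d / ε)) ≤ K)
    (hβ1 : 28 * (Real.log (N * (M.H * K)) + K * (ε ^ 2 / (M.H ^ 2 * d))) ≤ β)
    (hβ2 : β ≤ 28 * (1 + m) * (Real.log (N * (M.H * K)) + K * (ε ^ 2 / (M.H ^ 2 * d)))) :
    1 / 2 ≤ probOptimal Pr M greedy K f ((10 + 200 * (28 * (1 + m))) * ε) := by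
  have hHr : (1 : ℝ) ≤ M.H := by exact_mod_cast hs.pos
  have hdr : (1 : ℝ) ≤ d := by exact_mod_cast hd1
  have hNr : (1 : ℝ) ≤ N := by exact_mod_cast hs.one_le_coverNum hN
  have hK2 : (2 : ℝ) ≤ K := two_le_episodes hHr hdr hNr hε hε2 hL
  have hHd : (M.H : ℝ) * d ≤ K * ε := mul_le_episodes_mul hHr hdr hNr hε hε2 hL
  have hlog := log_episodes_le hHr hdr hNr hε hε2 hL
  set x : ℝ := N * (M.H * K) with hx
  have hxK : (K : ℝ) ≤ x := by
    rw [hx]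
    have : (K : ℝ) ≤ M.H * K := le_mul_of_one_le_left (by linarith) hHr
    exact this.trans (le_mul_of_one_le_left (by positivity) hNr)
  have hlog0 : 0 ≤ Real.log x := Real.log_nonneg (by linarith)
  set ρ : ℝ := ε ^ 2 / (M.H ^ 2 * d) with hρ
  have hρ0 : 0 ≤ ρ := by positivity
  have hKρ0 : 0 ≤ K * ρ := by positivity
  -- At this level the bad event has probability at most `2x * x⁻³ ≤ 1/K`, so it costs at most `3H ≤
  -- 3Kε` in expected regret.
  obtain ⟨B, hB, hPB, hgood⟩ := run.exists_bad_event hs hρ0 hN (3 * Real.log x)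
  set b : ℝ := 3 * Real.log x + 28 * K * ρ with hb
  have hbβ : b ≤ β := by linarith
  have hb0 : 0 ≤ b := by positivity
  have hPB' : Pr.real B ≤ 1 / K := by
    refine ENNReal.toReal_le_of_le_ofReal (by positivity) (hPB.trans ?_)
    rw [← ENNReal.ofReal_natCast, ← ENNReal.ofReal_mul (by positivity)]
    refine ENNReal.ofReal_le_ofReal (le_trans (le_of_eq ?_) (two_mul_mul_exp_neg_log_le hK2 hxK))
    rw [hx]
    push_cast
    ring
  have hmain := run.sum_integral_regret_le hs hbβ (by linarith) hB hgood
    (div_pos hε (by linarith : (0 : ℝ) < M.H)) hd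
  refine half_le_probOptimal_of_sum_regret run hs hK (by positivity) (hmain.trans ?_)
  set c : ℝ := 28 * (1 + m) with hc
  have hc1 : 1 ≤ c := by linarith
  have hsqrt : √(d * (5 * (β + b)) * K) ≤ 50 * c * (K * ε / M.H) := by
    refine Real.sqrt_le_iff.mpr ⟨by positivity, ?_⟩
    -- Both terms are at most `β ≤ c (log x + K ρ)`, and `log x ≤ 4 K ρ`.
    have h1 : β + b ≤ 10 * c * (K * ρ) := by
      have h2 : c * (Real.log x + K * ρ) ≤ c * (5 * (K * ρ)) :=
        mul_le_mul_of_nonneg_left (by linarith) (by linarith)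
      linarith
    calc d * (5 * (β + b)) * K ≤ d * (5 * (10 * c * (K * ρ))) * K := by gcongr
      _ = 50 * c * (K * ε / M.H) ^ 2 := by
          rw [hρ]
          field_simp
          ring
      _ ≤ (50 * c) ^ 2 * (K * ε / M.H) ^ 2 := by
          gcongr
          nlinarith
      _ = (50 * c * (K * ε / M.H)) ^ 2 := by ring
  have hfirst : M.H * (K * (ε / M.H) + d + 2 * √(d * (5 * (β + b)) * K))
      ≤ K * ε + M.H * d + 100 * c * (K * ε) := by
    calc M.H * (K * (ε / M.H) + d + 2 * √(d * (5 * (β + b)) * K))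
        ≤ M.H * (K * (ε / M.H) + d + 2 * (50 * c * (K * ε / M.H))) := by gcongr
      _ = K * ε + M.H * d + 100 * c * (K * ε) := by
          field_simp
          ring
  have hsecond : 3 * M.H * K * Pr.real B ≤ 3 * (K * ε) := by
    calc 3 * M.H * K * Pr.real B ≤ 3 * M.H * K * (1 / K) := by gcongr
      _ = 3 * M.H := by field_simp
      _ ≤ 3 * (K * ε) := by nlinarith
  linarith

end Main

end Golf

end

theorem corollary2 :
    ∀ m : ℝ, 1 ≤ m → ∃ c : ℝ, 0 < c ∧ ∃ C : ℝ, 0 < C ∧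
      ∀ (S A Ω : Type*) [MeasurableSpace S] [MeasurableSpace A] [MeasurableSpace Ω]
        (Pr : MeasureTheory.Measure Ω) [MeasureTheory.IsProbabilityMeasure Pr]
        (M : Golf.MDP S A) (F G : ℕ → Set (S × A → ℝ))
        (greedy : Golf.QTuple S A → ℕ → S → A),
        0 < M.H →
        Golf.IsFunctionClass M.H F → Golf.IsFunctionClass M.H G →
        Golf.IsGreedyRule M.H F greedy →
        Golf.Realizable M F → Golf.Complete M F G →
      ∀ (ε : ℝ), 0 < ε → ε ≤ 1 →
      ∀ (d N K : ℕ) (ρ L β : ℝ),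
        (d : ℕ∞) = max 1
          (min (Golf.dimBE M F (Golf.diracFamily S A) (ε / M.H))
            (Golf.dimBE M F (Golf.greedyFamily M F greedy) (ε / M.H))) →
        ρ = ε ^ 2 / (M.H ^ 2 * d) →
        (N : ℕ∞) = Golf.coverNum (Golf.tuples M.H F ∪ Golf.tuples M.H G) ρ →
        L = M.H ^ 2 * d / ε ^ 2 * Real.log (N * (M.H * d / ε)) →
        1 ≤ K → L ≤ K →
        (β = c * (Real.log (N * (M.H * K)) + K * ρ) ∨
          (K ≤ m * L ∧ β = c * Real.log (N * (M.H * K)))) →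
      ∀ (𝓖 : ℕ → ℕ → MeasurableSpace Ω) (s : ℕ → ℕ → Ω → S) (f : ℕ → Ω → Golf.QTuple S A),
        Golf.IsRun Pr M F G greedy K β 𝓖 s f →
        1 / 2 ≤ Golf.probOptimal Pr M greedy K f (C * ε) := by
  intro m hm
  -- The 28 comes from the covering error, and `1 + m` lets the logarithm absorb `K ρ` in the second
  -- case. `C` is twice `5 + 100c`: one for the threshold `ω`, one for `d`, three for the bad event,
  -- `100c` for the root.
  refine ⟨28 * (1 + m), by linarith, 10 + 200 * (28 * (1 + m)), by linarith, ?_⟩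
  intro S A Ω _ _ _ Pr _ M F G greedy hH hF hG hgr hreal hcomp ε hε hε1 d N K ρ L β hd hρ hN hL hK
    hLK hβ 𝓖 s f run
  have hs : Golf.Setting M F G greedy := ⟨hH, hF, hG, hgr, hreal, hcomp⟩
  -- For larger `ε` one has `C ε ≥ 1`, which exceeds every possible regret.
  by_cases hε2 : ε ≤ 1 / 2
  · subst hρ hL
    have hd1 : 1 ≤ d := by
      have h1 : (1 : ℕ∞) ≤ d := hd ▸ le_max_left _ _
      exact_mod_cast h1
    have hmin : min (Golf.dimBE M F (Golf.diracFamily S A) (ε / M.H))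
        (Golf.dimBE M F (Golf.greedyFamily M F greedy) (ε / M.H)) ≤ d := hd ▸ le_max_right _ _
    have hHr : (1 : ℝ) ≤ M.H := by exact_mod_cast hH
    have hdr : (1 : ℝ) ≤ d := by exact_mod_cast hd1
    have hNr : (1 : ℝ) ≤ N := by exact_mod_cast hs.one_le_coverNum hN
    have hKr : (1 : ℝ) ≤ K := by exact_mod_cast hK
    have hbounds := Golf.confidence_level_bounds hm
      (Golf.log_size_le_log_episodes hHr hdr hNr hε hε2 hLK)
      (Real.log_nonneg (one_le_mul_of_one_le_of_one_le hNr
        (one_le_mul_of_one_le_of_one_le hHr hKr)))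
      (by positivity : 0 ≤ K * (ε ^ 2 / (M.H ^ 2 * d)))
      -- Multiplying `K ≤ m L` by `ρ` cancels the prefactor of the logarithm in `L`.
      (hβ.imp id fun h => ⟨by
        have h1 : K * (ε ^ 2 / (M.H ^ 2 * d)) ≤ m * (M.H ^ 2 * d / ε ^ 2
            * Real.log (N * (M.H * d / ε))) * (ε ^ 2 / (M.H ^ 2 * d)) :=
          mul_le_mul_of_nonneg_right h.1 (by positivity)
        refine h1.trans (le_of_eq ?_)
        field_simp, h.2⟩)
    exact run.half_le_probOptimal hs hm hε hε2 hd1 (min_le_iff.mp hmin) hN hK hLK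
      hbounds.1 hbounds.2
  · rw [Golf.probOptimal_eq_one_of_one_le run hs hK
      (by nlinarith : 1 ≤ (10 + 200 * (28 * (1 + m))) * ε)]
    exact ENNReal.half_le_self
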